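/- Let $n\ge 0$ and $m\ge 1$ be integers and let $G_{n,m}=S_n\wr\mathbb Z_m$, realized as the group of $n\times n$ complex matrices with exactly one nonzero entry in each row and each column, these entries being $m$-th roots of unity. For $g\in G_{n,m}$ let $w(g)$ be the product of its nonzero entries and $|g|$ the matrix of the moduli of its entries. The quasi-symmetrizing action of $G_{n,m}$ on $\mathbb C[X]=\mathbb C[x_1,\dots,x_n]$ is defined linearly on monomials as follows. Write a monomial as $A^K=x_{a_1}^{k_1}\cdots x_{a_l}^{k_l}$ with $a_1<\dots<a_l$ and all $k_i>0$, and put $$g\bullet A^K=w(g)^{c(K)}\,\bigl((A\cdot{}^t|g|)_<\bigr)^K,$$ where $A\cdot{}^t|g|$ is the list of variables obtained from $A=(x_{a_1},\dots,x_{a_l})$ by replacing each $x_i$ by $\sum_j |g_{ij}|\,x_j$ (which is a single variable), $(\cdot)_<$ rearranges this list in increasing order of the indices, and $c(K)=0$ if every $k_i$ is divisible by $m$, $c(K)=1$ otherwise. Let $QInv_{n,m}=\{P\in\mathbb C[X] : g\bullet P=P \text{ for all } g\in G_{n,m}\}$, let $QInv^+_{n,m}$ be the set of its elements without constant term, and let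 $\langle QInv^+_{n,m}\rangle$ be the ideal of $\mathbb C[X]$ generated by it. With the bilinear form $\langle P,Q\rangle = P(\partial_{x_1},\dots,\partial_{x_n})\,Q\,\big|_{x_1=\dots=x_n=0}$ on $\mathbb C[X]$, the space of super-coinvariant polynomials $$SCov_{n,m}=\{P\in\mathbb C[X] : Q(\partial_{x_1},\dots,\partial_{x_n})P=0 \text{ for all } Q\in QInv^+_{n,m}\}$$ is equal to the orthogonal $\langle QInv^+_{n,m}\rangle^{\perp}$, is isomorphic as a vector space to $\mathbb C[X]/\langle QInv^+_{n,m}\rangle$, and has dimension $$\dim SCov_{n,m}=m^n\,C_n=m^n\,\frac1{n+1}\binom{2n}{n},$$ where $C_n$ is the $n$-th Catalan number. -/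

import Mathlib

open MvPolynomial

noncomputable section

namespace QuasiInv

/-- The generalized symmetric group `G_{n,m} = S_n ≀ ℤ_m`, with `ℤ_m` realized as the group of
`m`-th roots of unity in `ℂ`: the semidirect product of `(μ_m)^n` by `S_n` permuting coordinates. -/
abbrev GenSymm (n m : ℕ) : Type :=
  (Fin n → rootsOfUnity m ℂ) ⋊[mulAutArrow] Equiv.Perm (Fin n)

/-- The pseudo-permutation matrix of `g = (ε, σ)`: its nonzero entries are `ε i` at `(i, σ⁻¹ i)`. -/
def toMatrix {n m : ℕ} (g : GenSymm n m) : Matrix (Fin n) (Fin n) ℂ :=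
  fun i j => if j = g.right⁻¹ i then ((g.left i : ℂˣ) : ℂ) else 0

/-- The weight `w(g)`: the product of the nonzero entries of the matrix of `g`. -/
def weight {n m : ℕ} (g : GenSymm n m) : ℂ := ∏ i, ((g.left i : ℂˣ) : ℂ)

/-- The variables occurring in `A · ᵗ|g|`, for a set `A` of variables. The `i`-th entry of
`(x₁, …, xₙ) · ᵗ|g|` is `∑ j, |g i j| x_j = x_{σ⁻¹ i}`. -/
def moveVars {n m : ℕ} (g : GenSymm n m) (A : Finset (Fin n)) : Finset (Fin n) :=
  A.map g.right⁻¹.toEmbedding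

/-- The exponent vector of `(A · ᵗ|g|)_<^K`, where `X^ν = A^K` with `A` the increasing list of the
variables occurring in `X^ν` and `K` the list of their (positive) exponents: the `r`-th variable
of `A · ᵗ|g|`, in increasing order, receives the exponent of the `r`-th variable of `A`. -/
def moveExp {n m : ℕ} (g : GenSymm n m) (ν : Fin n →₀ ℕ) : Fin n →₀ ℕ :=
  ∑ r : Fin ν.support.card,
    Finsupp.single
      ((moveVars g ν.support).orderEmbOfFin (Finset.card_map _) r)
      (ν (ν.support.orderEmbOfFin rfl r))

/-- The coefficient `c(K)`: `0` if all the positive exponents are divisible by `m`, else `1`. -/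
def cExp {n : ℕ} (m : ℕ) (ν : Fin n →₀ ℕ) : ℕ :=
  if ∀ i ∈ ν.support, ν i ≡ 0 [MOD m] then 0 else 1

/-- The quasi-symmetrizing action of `g`: the linear map with
`g • A^K = w(g)^{c(K)} (A · ᵗ|g|)_<^K`. -/
def quasiAct {n m : ℕ} (g : GenSymm n m) :
    MvPolynomial (Fin n) ℂ →ₗ[ℂ] MvPolynomial (Fin n) ℂ :=
  (basisMonomials (Fin n) ℂ).constr ℂ
    (fun ν => monomial (moveExp g ν) (weight g ^ cExp m ν))

/-- The space of quasi-invariant polynomials. -/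
def QInv (n m : ℕ) : Submodule ℂ (MvPolynomial (Fin n) ℂ) where
  carrier := {P | ∀ g : GenSymm n m, quasiAct g P = P}
  add_mem' hP hQ g := by rw [map_add, hP g, hQ g]
  zero_mem' g := map_zero _
  smul_mem' a P hP g := by rw [map_smul, hP g]

/-- The quasi-invariant polynomials without constant term. -/
def QInvPlus (n m : ℕ) : Set (MvPolynomial (Fin n) ℂ) :=
  {P | P ∈ QInv n m ∧ constantCoeff P = 0}

/-- The ideal generated by the quasi-invariant polynomials without constant term. -/
def quasiIdeal (n m : ℕ) : Ideal (MvPolynomial (Fin n) ℂ) := Ideal.span (QInvPlus n m)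

/-- `P ↦ P(∂X)`: the linear map sending `X^ν` to `∂₁^{ν₁} ⋯ ∂ₙ^{νₙ}`. -/
def diffOp (n : ℕ) :
    MvPolynomial (Fin n) ℂ →ₗ[ℂ] Module.End ℂ (MvPolynomial (Fin n) ℂ) :=
  (basisMonomials (Fin n) ℂ).constr ℂ
    (fun ν => (List.ofFn fun i : Fin n =>
      ((pderiv i).toLinearMap : Module.End ℂ (MvPolynomial (Fin n) ℂ)) ^ ν i).prod)

/-- The scalar product `⟨P, Q⟩ = P(∂X) Q(X) |_{X = 0}`. -/
def pairing {n : ℕ} (P Q : MvPolynomial (Fin n) ℂ) : ℂ := eval 0 (diffOp n P Q)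

/-- The space of super-coinvariant polynomials. -/
def SCov (n m : ℕ) : Submodule ℂ (MvPolynomial (Fin n) ℂ) where
  carrier := {P | ∀ Q ∈ QInvPlus n m, diffOp n Q P = 0}
  add_mem' hP hR Q hQ := by rw [map_add, hP Q hQ, hR Q hQ, add_zero]
  zero_mem' Q _ := map_zero _
  smul_mem' a P hP Q hQ := by rw [map_smul, hP Q hQ, smul_zero]

theorem toMatrix_mul {n m : ℕ} (g h : GenSymm n m) :
    toMatrix (g * h) = toMatrix g * toMatrix h := by
  ext i k
  rw [Matrix.mul_apply, Finset.sum_eq_single (g.right⁻¹ i)]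
  · by_cases hk : k = h.right⁻¹ (g.right⁻¹ i)
    · subst hk
      simp only [toMatrix, SemidirectProduct.mul_right, SemidirectProduct.mul_left, mul_inv_rev,
        Equiv.Perm.mul_apply, if_true, Pi.mul_apply, Subgroup.coe_mul, Units.val_mul]
      rfl
    · simp only [toMatrix, SemidirectProduct.mul_right, mul_inv_rev, Equiv.Perm.mul_apply,
        if_neg hk, mul_zero]
  · intro j _ hj
    simp only [toMatrix, if_neg hj, zero_mul]
  · simp

theorem weight_eq_prod_entries {n m : ℕ} (g : GenSymm n m) :
    weight g = ∏ i, ∏ j, if toMatrix g i j = 0 then 1 else toMatrix g i j := by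
  refine Finset.prod_congr rfl fun i _ => ?_
  rw [Finset.prod_eq_single (g.right⁻¹ i)]
  · simp only [toMatrix, if_true, if_neg (Units.ne_zero _)]
  · intro j _ hj
    simp only [toMatrix, if_neg hj, if_true]
  · simp

theorem mem_moveVars {n m : ℕ} (g : GenSymm n m) (A : Finset (Fin n)) (j : Fin n) :
    j ∈ moveVars g A ↔ ∃ i ∈ A, toMatrix g i j ≠ 0 := by
  have hne (i : Fin n) : toMatrix g i j ≠ 0 ↔ g.right⁻¹ i = j := by
    by_cases hj : j = g.right⁻¹ i
    · simp only [toMatrix, hj.symm, iff_true]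
      exact Units.ne_zero _
    · simp only [toMatrix, if_neg hj, Ne.symm hj, ne_eq, not_true_eq_false]
  simp only [hne, moveVars, Finset.mem_map, Equiv.coe_toEmbedding]

end QuasiInv

end

/-! A polynomial is quasi-invariant exactly when all its exponents are divisible by `m` and its
coefficients depend only on the sequence of nonzero exponents (`mem_QInv_iff`). So `quasiIdeal n m`
is generated by the monomial quasi-symmetric functions of positive degree in `x_1^m, …, x_n^m`.
Writing an exponent as `ρ + m κ` with all `ρ_i < m` splits the problem into `m^n` copies of the case
of ordinary quasi-symmetric functions, where the quotient has dimension `C_n` (Aval, Bergeron and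
Bergeron). Call an exponent under the diagonal if each of its initial segments of length `j ≥ 1` has
sum less than `j`; there are `C_n` of these (`length_underDiag_zero`).

Spanning. For each exponent not under the diagonal, a combination of fundamental quasi-symmetric
functions with polynomial coefficients lies in the ideal and has that exponent as its lexicographic
leading term (`grobner_mem`, `grobner_sub_mon_mem_lexLower`). Lexicographic induction then reduces
every monomial to those under the diagonal.

Independence. The operator `f ↦ (f(…, x_i, 0, …) - f(…, 0, x_i, …)) / x_i` lowers the number of
variables by one and kills quasi-symmetric polynomials. It also maps the ideal for `n + 1` variables
into the ideal for `n`. Its transpose `trim` therefore turns functionals annihilating the ideal into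
others. Starting from evaluation at the origin, this gives for each `ν` under the diagonal a
functional with value 1 at `ν` that vanishes at all exponents lexicographically below `ν`
(`exists_annihilates`). The matrix of these functionals on the basis monomials is triangular, hence
invertible (`isUnit_gram`).

Duality. Multiplication by `Q` is adjoint to `Q(∂)`, so the super-coinvariants are the orthogonal of
the ideal (`mem_SCov_iff`). The annihilating functionals have finite support on monomials, hence are
represented by polynomials, and so the orthogonal has the dimension of the quotient. -/

namespace QuasiInv
open List

/-! ### Fundamental quasi-symmetric functions and the Gröbner elements. -/

section Quasisymmetric

variable {R : Type*} [CommRing R]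

/-- The monomial quasi-symmetric function evaluated at a list of ring elements; the entry `k` of
the indexing list encodes the part `k + 1`. -/
def monomialQSym : List ℕ → List R → R
  | [], _ => 1
  | _ :: _, [] => 0
  | k :: K, x :: xs => monomialQSym (k :: K) xs + x ^ (k + 1) * monomialQSym K xs

/-- Sum of `h` over the refinements of a single part `a + 1` followed by a fixed tail. -/
def refinePart : ℕ → (ℕ → List ℕ → R) → List ℕ → R
  | 0, h => h 0
  | a + 1, h => refinePart a fun k K => h (k + 1) K + h 0 (k :: K)

/-- Sum of `h` over the compositions refining a given one. -/
def refineSum : List ℕ → (List ℕ → R) → R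
  | [], h => h []
  | a :: c, h => refineSum c (refinePart a fun k K => h (k :: K))

/-- The fundamental quasi-symmetric function evaluated at a list of ring elements. -/
def fundamentalQSym (c : List ℕ) (xs : List R) : R := refineSum c fun K => monomialQSym K xs

theorem refinePart_add_mul (a : ℕ) (u : R) (h₁ h₂ : ℕ → List ℕ → R) :
    refinePart a (fun k K => h₁ k K + u * h₂ k K) =
      fun K => refinePart a h₁ K + u * refinePart a h₂ K := by
  induction a generalizing h₁ h₂ with
  | zero => rfl
  | succ a ih =>
    simp only [refinePart]
    rw [← ih]
    congr 1
    funext k K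
    ring

theorem refineSum_add_mul (c : List ℕ) (u : R) (h₁ h₂ : List ℕ → R) :
    refineSum c (fun K => h₁ K + u * h₂ K) = refineSum c h₁ + u * refineSum c h₂ := by
  induction c generalizing h₁ h₂ with
  | nil => rfl
  | cons a c ih =>
    simp only [refineSum]
    rw [← ih, refinePart_add_mul]

theorem fundamentalQSym_nil (xs : List R) : fundamentalQSym [] xs = 1 := by
  cases xs <;> rfl

theorem fundamentalQSym_zero_cons (c : List ℕ) (x : R) (xs : List R) :
    fundamentalQSym (0 :: c) (x :: xs) =
      fundamentalQSym (0 :: c) xs + x * fundamentalQSym c xs := by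
  simp only [fundamentalQSym, refineSum, refinePart]
  rw [← refineSum_add_mul]
  simp only [monomialQSym, zero_add, pow_one]

theorem fundamentalQSym_succ_cons (a : ℕ) (c : List ℕ) (x : R) (xs : List R) :
    fundamentalQSym ((a + 1) :: c) (x :: xs) =
      fundamentalQSym ((a + 1) :: c) xs + x * fundamentalQSym (a :: c) (x :: xs) := by
  simp only [fundamentalQSym, refineSum, refinePart]
  rw [← refineSum_add_mul, ← refinePart_add_mul]
  congr 2
  funext k K
  simp only [monomialQSym]
  ring

theorem refinePart_mem {I : Ideal R} (a : ℕ) (h : ℕ → List ℕ → R) (H : ∀ k K, h k K ∈ I)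
    (K : List ℕ) : refinePart a h K ∈ I := by
  induction a generalizing h with
  | zero => exact H 0 K
  | succ a ih => exact ih _ fun k K => I.add_mem (H _ _) (H _ _)

theorem refineSum_mem {I : Ideal R} (c : List ℕ) (h : List ℕ → R) (H : ∀ K, h K ∈ I) :
    refineSum c h ∈ I := by
  induction c generalizing h with
  | nil => exact H _
  | cons a c ih => exact ih _ fun K => refinePart_mem _ _ (fun k K => H _) _

theorem fundamentalQSym_mem {I : Ideal R} {xs : List R}
    (H : ∀ k K, monomialQSym (k :: K) xs ∈ I) (a : ℕ) (c : List ℕ) :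
    fundamentalQSym (a :: c) xs ∈ I :=
  refineSum_mem c _ fun _ => refinePart_mem _ _ H _

/-- Iterating the two one-step recursions isolates the top power of `x`: every other term has a
smaller power of `x` and a coefficient in the remaining variables, which is what leading terms
require. -/
theorem fundamentalQSym_cons (a : ℕ) (c : List ℕ) (x : R) (xs : List R) :
    fundamentalQSym (a :: c) (x :: xs) = x ^ (a + 1) * fundamentalQSym c xs +
      ∑ j ∈ Finset.range (a + 1), x ^ j * fundamentalQSym ((a - j) :: c) xs := by
  induction a with
  | zero => simp [fundamentalQSym_zero_cons, add_comm]
  | succ a ih =>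
    rw [fundamentalQSym_succ_cons, ih, Finset.sum_range_succ' _ (a + 1)]
    simp only [Nat.add_sub_add_right, pow_succ', mul_add, Finset.mul_sum, mul_assoc]
    simp only [pow_zero, one_mul, Nat.sub_zero]
    ring

/-- The expansion of the index `0 :: c` in terms of the family `h` indexed by compositions. -/
def dropZero (x : R) (h : List ℕ → R) : List ℕ → R
  | [] => h []
  | 0 :: c => h (0 :: c) - x * dropZero x h c
  | (a + 1) :: c => h ((a + 1) :: c) - x * h (a :: c)

/-- The expansion, in terms of the family `h` indexed by compositions, of the Gröbner basis
element with leading exponent `ν`. -/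
def grobner : List ℕ → List R → (List ℕ → R) → R
  | [], _, h => h []
  | _ :: _, [], h => h []
  | 0 :: ν, x :: xs, h => grobner ν xs (dropZero x h)
  | (b + 1) :: ν, _ :: xs, h => grobner ν xs fun c => h (b :: c)

theorem dropZero_add_mul (x u : R) (h₁ h₂ : List ℕ → R) :
    dropZero x (fun c => h₁ c + u * h₂ c) =
      fun c => dropZero x h₁ c + u * dropZero x h₂ c := by
  funext c
  induction c with
  | nil => rfl
  | cons a c ih =>
    cases a with
    | zero => simp only [dropZero, ih]; ring
    | succ a => simp only [dropZero]; ring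

theorem grobner_add_mul (ν : List ℕ) (xs : List R) (u : R) (h₁ h₂ : List ℕ → R) :
    grobner ν xs (fun c => h₁ c + u * h₂ c) = grobner ν xs h₁ + u * grobner ν xs h₂ := by
  induction ν generalizing xs h₁ h₂ with
  | nil => rfl
  | cons b ν ih =>
    cases xs with
    | nil => rfl
    | cons x xs =>
      cases b with
      | zero => simp only [grobner, dropZero_add_mul, ih]
      | succ b => simp only [grobner, ih]

theorem grobner_sum_mul (ν : List ℕ) (xs : List R) (N : ℕ) (u : ℕ → R) (h₀ : List ℕ → R)
    (h : ℕ → List ℕ → R) :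
    grobner ν xs (fun c => h₀ c + ∑ j ∈ Finset.range N, u j * h j c) =
      grobner ν xs h₀ + ∑ j ∈ Finset.range N, u j * grobner ν xs (h j) := by
  induction N with
  | zero => simp
  | succ N ih => simp only [Finset.sum_range_succ, ← add_assoc, grobner_add_mul, ih]

/-- `dropZero` solves the recursions for the terms not containing `x`. -/
theorem dropZero_fundamentalQSym (x : R) (xs : List R) (c : List ℕ) :
    dropZero x (fun c => fundamentalQSym c (x :: xs)) c = fundamentalQSym c xs := by
  induction c with
  | nil => simp only [dropZero, fundamentalQSym_nil]
  | cons a c ih =>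
    cases a with
    | zero => simp only [dropZero, ih, fundamentalQSym_zero_cons, add_sub_cancel_right]
    | succ a => simp only [dropZero, fundamentalQSym_succ_cons a, add_sub_cancel_right]

/-- Some nonempty initial segment of length `j` has sum at least `j + d`. -/
def TransDiag : ℕ → List ℕ → Prop
  | _, [] => False
  | d, b :: ν => d < b ∨ TransDiag (d + 1 - b) ν

/-- The condition `TransDiag` for a composition whose parts are encoded with a shift by one. -/
def CompTransDiag : ℕ → List ℕ → Prop
  | _, [] => False
  | d, a :: c => d ≤ a ∨ CompTransDiag (d - a) c

/-- Unfolded, `CompTransDiag d c` means that `c` is nonempty and its encoded entries sum to at least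
`d`; equivalently the size of the composition exceeds its length by at least `d`. -/
theorem CompTransDiag.mono {d e : ℕ} (hde : d ≤ e) {c : List ℕ} (h : CompTransDiag e c) :
    CompTransDiag d c := by
  induction c generalizing d e with
  | nil => exact h
  | cons a c ih =>
    rcases h with h | h
    · exact Or.inl (hde.trans h)
    · exact Or.inr (ih (by omega) h)

/-- Each index occurring in the expansion has lost at most one unit of encoded sum; an initial `0`
is removed without any loss. -/
theorem dropZero_mem {I : Ideal R} {d : ℕ} {h : List ℕ → R} (x : R)
    (H : ∀ c, CompTransDiag d c → h c ∈ I) {c : List ℕ} (hc : CompTransDiag (d + 1) c) :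
    dropZero x h c ∈ I := by
  induction c with
  | nil => exact hc.elim
  | cons a c ih =>
    have h₁ : h (a :: c) ∈ I := H _ (hc.mono (Nat.le_succ d))
    cases a with
    | zero =>
      refine I.sub_mem h₁ (I.mul_mem_left _ (ih ?_))
      rcases hc with hc | hc
      · omega
      · exact hc
    | succ a =>
      refine I.sub_mem h₁ (I.mul_mem_left _ (H _ ?_))
      rcases hc with hc | hc
      · exact Or.inl (by omega)
      · exact Or.inr (hc.mono (by omega))

theorem dropZero_mem_of_forall {S : Subring R} {h : List ℕ → R} {x : R} (hx : x ∈ S)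
    (H : ∀ c, h c ∈ S) (c : List ℕ) : dropZero x h c ∈ S := by
  induction c with
  | nil => exact H _
  | cons a c ih =>
    cases a with
    | zero => exact S.sub_mem (H _) (S.mul_mem hx ih)
    | succ a => exact S.sub_mem (H _) (S.mul_mem hx (H _))

theorem grobner_mem_of_forall {I : Ideal R} (ν : List ℕ) (xs : List R) {h : List ℕ → R}
    (H : ∀ c, h c ∈ I) : grobner ν xs h ∈ I := by
  induction ν generalizing xs h with
  | nil => exact H _
  | cons b ν ih =>
    cases xs with
    | nil => exact H _
    | cons x xs =>
      cases b with
      | zero =>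
        refine ih _ fun c => ?_
        induction c with
        | nil => exact H _
        | cons a c ih =>
          cases a with
          | zero => exact I.sub_mem (H _) (I.mul_mem_left _ ih)
          | succ a => exact I.sub_mem (H _) (I.mul_mem_left _ (H _))
      | succ b => exact ih _ fun c => H _

theorem grobner_mem_subring {S : Subring R} (ν : List ℕ) (xs : List R) (hxs : ∀ x ∈ xs, x ∈ S)
    {h : List ℕ → R} (H : ∀ c, h c ∈ S) : grobner ν xs h ∈ S := by
  induction ν generalizing xs h with
  | nil => exact H _
  | cons b ν ih =>
    cases xs with
    | nil => exact H _
    | cons x xs =>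
      have hxs' : ∀ y ∈ xs, y ∈ S := fun y hy => hxs y (mem_cons_of_mem _ hy)
      cases b with
      | zero => exact ih _ hxs' (dropZero_mem_of_forall (hxs x mem_cons_self) H)
      | succ b => exact ih _ hxs' fun c => H _

theorem monomialQSym_mem_subring {S : Subring R} (K : List ℕ) (xs : List R)
    (hxs : ∀ x ∈ xs, x ∈ S) : monomialQSym K xs ∈ S := by
  induction xs generalizing K with
  | nil =>
    cases K with
    | nil => exact S.one_mem
    | cons k K => exact S.zero_mem
  | cons x xs ih =>
    have hxs' : ∀ y ∈ xs, y ∈ S := fun y hy => hxs y (mem_cons_of_mem _ hy)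
    cases K with
    | nil => exact S.one_mem
    | cons k K =>
      exact S.add_mem (ih _ hxs') (S.mul_mem (S.pow_mem (hxs x mem_cons_self) _) (ih _ hxs'))

theorem fundamentalQSym_mem_subring {S : Subring R} (c : List ℕ) (xs : List R)
    (hxs : ∀ x ∈ xs, x ∈ S) : fundamentalQSym c xs ∈ S := by
  have key : ∀ (h : List ℕ → R), (∀ K, h K ∈ S) → refineSum c h ∈ S := by
    induction c with
    | nil => exact fun h H => H _
    | cons a c ih =>
      refine fun h H => ih _ ?_
      have H' : ∀ k K, (fun k K => h (k :: K)) k K ∈ S := fun k K => H _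
      generalize (fun k K => h (k :: K)) = g at H'
      induction a generalizing g with
      | zero => exact H' 0
      | succ a ih => exact ih _ fun k K => S.add_mem (H' _ _) (H' _ _)
  exact key _ fun K => monomialQSym_mem_subring K xs hxs

/-- The threshold `d` follows the path of `ν`: a zero entry raises it by one, an entry `b + 1`
lowers it by `b`. Once the path crosses the diagonal, prefixing `b` alone meets the threshold, so
all later terms lie in `I`. -/
theorem grobner_mem {I : Ideal R} {d : ℕ} (ν : List ℕ) (xs : List R) {h : List ℕ → R}
    (H : ∀ c, CompTransDiag d c → h c ∈ I) (hν : TransDiag d ν) (hl : ν.length = xs.length) :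
    grobner ν xs h ∈ I := by
  induction ν generalizing xs h d with
  | nil => exact hν.elim
  | cons b ν ih =>
    cases xs with
    | nil => simp at hl
    | cons x xs =>
      have hl' : ν.length = xs.length := by simpa using hl
      cases b with
      | zero =>
        rcases hν with hν | hν
        · omega
        · exact ih _ (fun c hc => dropZero_mem x H hc) hν hl'
      | succ b =>
        rcases hν with hν | hν
        · exact grobner_mem_of_forall _ _ (h := fun c => h (b :: c)) fun c =>
            H (b :: c) (Or.inl (by omega))
        · refine ih (h := fun c => h (b :: c)) (d := d - b) _
            (fun c hc => H (b :: c) (Or.inr hc)) ?_ hl'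
          convert hν using 1
          omega

/-- The monomial with exponents `μ` in a list of ring elements. -/
def mon : List ℕ → List R → R
  | a :: μ, x :: xs => x ^ a * mon μ xs
  | _, _ => 1

/-! ### Lexicographic leading terms and reduction to monomials under the diagonal. -/

variable (k : Type*) [CommRing k] [Algebra k R]

theorem mon_mul_mon (xs : List R) (μ ν : List ℕ) (hμ : μ.length = xs.length)
    (hν : ν.length = xs.length) : mon μ xs * mon ν xs = mon (zipWith (· + ·) μ ν) xs := by
  induction xs generalizing μ ν with
  | nil =>
    simp only [length_nil, length_eq_zero_iff] at hμ hν
    subst hμ hν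
    simp [mon]
  | cons x xs ih =>
    cases μ with
    | nil => simp at hμ
    | cons a μ =>
      cases ν with
      | nil => simp at hν
      | cons b ν =>
        simp only [mon, zipWith_cons_cons]
        rw [← ih μ ν (by simpa using hμ) (by simpa using hν), pow_add]
        ring

theorem mon_replicate_zero (xs : List R) : mon (replicate xs.length 0) xs = 1 := by
  induction xs with
  | nil => rfl
  | cons x xs ih => simp [replicate_succ, mon, ih]

theorem mem_range_mon (xs : List R) {x : R} (hx : x ∈ xs) :
    ∃ μ : List ℕ, μ.length = xs.length ∧ mon μ xs = x := by
  induction xs with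
  | nil => simp at hx
  | cons y xs ih =>
    rcases mem_cons.1 hx with rfl | hx
    · exact ⟨1 :: replicate xs.length 0, by simp, by simp [mon, mon_replicate_zero]⟩
    · obtain ⟨μ, hμ, rfl⟩ := ih hx
      exact ⟨0 :: μ, by simpa using hμ, by simp [mon]⟩

theorem adjoin_le_span_mon (xs : List R) {y : R} (hy : y ∈ Algebra.adjoin k {x | x ∈ xs}) :
    y ∈ Submodule.span k {y | ∃ μ : List ℕ, μ.length = xs.length ∧ mon μ xs = y} := by
  induction hy using Algebra.adjoin_induction with
  | mem x hx => exact Submodule.subset_span (mem_range_mon xs hx)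
  | algebraMap r =>
    rw [Algebra.algebraMap_eq_smul_one]
    exact Submodule.smul_mem _ _
      (Submodule.subset_span ⟨replicate xs.length 0, by simp, mon_replicate_zero xs⟩)
  | add x y _ _ hx hy => exact Submodule.add_mem _ hx hy
  | mul x y _ _ hx hy =>
    have := Submodule.mul_mem_mul hx hy
    rw [Submodule.span_mul_span] at this
    refine Submodule.span_mono ?_ this
    rintro _ ⟨_, ⟨μ, hμ, rfl⟩, _, ⟨ν, hν, rfl⟩, rfl⟩
    exact ⟨_, by simp [hμ, hν], (mon_mul_mon xs μ ν hμ hν).symm⟩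

/-- The span of the monomials that are lexicographically smaller than `ν`. -/
def lexLower (ν : List ℕ) (xs : List R) : Submodule k R :=
  Submodule.span k {y | ∃ μ : List ℕ, μ.length = xs.length ∧ μ < ν ∧ mon μ xs = y}

theorem pow_mul_mem_lexLower {j b : ℕ} (hj : j < b) (ν : List ℕ) (x : R) (xs : List R) {y : R}
    (hy : y ∈ Algebra.adjoin k {x | x ∈ xs}) : x ^ j * y ∈ lexLower k (b :: ν) (x :: xs) := by
  have := Submodule.mem_map_of_mem (f := LinearMap.mulLeft k (x ^ j))
    (adjoin_le_span_mon k xs hy)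
  rw [Submodule.map_span] at this
  refine Submodule.span_mono ?_ this
  rintro _ ⟨_, ⟨μ, hμ, rfl⟩, rfl⟩
  exact ⟨j :: μ, by simpa using hμ, List.cons_lt_cons_iff.2 (Or.inl hj), rfl⟩

theorem pow_mul_mem_lexLower_cons (b : ℕ) (ν : List ℕ) (x : R) (xs : List R) {y : R}
    (hy : y ∈ lexLower k ν xs) : x ^ b * y ∈ lexLower k (b :: ν) (x :: xs) := by
  have := Submodule.mem_map_of_mem (f := LinearMap.mulLeft k (x ^ b)) hy
  rw [lexLower, Submodule.map_span] at this
  refine Submodule.span_mono ?_ this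
  rintro _ ⟨_, ⟨μ, hμ, hlt, rfl⟩, rfl⟩
  exact ⟨b :: μ, by simpa using hμ, List.cons_lt_cons_iff.2 (Or.inr ⟨rfl, hlt⟩), rfl⟩

/-- A zero entry passes to the functions of `xs` alone. For an entry `b + 1`, `fundamentalQSym_cons`
gives `x ^ (b + 1)` times the element for the tail, plus terms `x ^ j` with `j ≤ b` whose
coefficients are polynomials in `xs`, hence lower. -/
theorem grobner_sub_mon_mem_lexLower (ν : List ℕ) (xs : List R) (hl : ν.length = xs.length) :
    grobner ν xs (fun c => fundamentalQSym c xs) - mon ν xs ∈ lexLower k ν xs := by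
  induction ν generalizing xs with
  | nil => simp [grobner, mon, fundamentalQSym_nil]
  | cons b ν ih =>
    cases xs with
    | nil => simp at hl
    | cons x xs =>
      have hν := ih xs (by simpa using hl)
      cases b with
      | zero =>
        have := pow_mul_mem_lexLower_cons k 0 ν x xs hν
        simpa only [grobner, funext (dropZero_fundamentalQSym x xs), mon, pow_zero, one_mul]
          using this
      | succ b =>
        have hexp : grobner ((b + 1) :: ν) (x :: xs) (fun c => fundamentalQSym c (x :: xs)) =
            x ^ (b + 1) * grobner ν xs (fun c => fundamentalQSym c xs) +
              ∑ j ∈ Finset.range (b + 1),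
                x ^ j * grobner ν xs fun c => fundamentalQSym ((b - j) :: c) xs := by
          simp only [grobner, fundamentalQSym_cons]
          rw [grobner_sum_mul ν xs (b + 1) (fun j => x ^ j) _
            (fun j c => fundamentalQSym ((b - j) :: c) xs)]
          congr 1
          have := grobner_add_mul ν xs (x ^ (b + 1)) (fun _ => 0) fun c => fundamentalQSym c xs
          have h0 : grobner ν xs (fun _ => (0 : R)) = 0 := by
            have := grobner_mem_of_forall (I := (⊥ : Ideal R)) ν xs (h := fun _ => 0)
              fun _ => Ideal.zero_mem _
            simpa using this
          simpa [h0] using this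
        rw [hexp, mon, add_sub_right_comm, ← mul_sub]
        refine Submodule.add_mem _ (pow_mul_mem_lexLower_cons k _ ν x xs hν)
          (Submodule.sum_mem _ fun j hj => ?_)
        refine pow_mul_mem_lexLower k (Finset.mem_range.1 hj) ν x xs ?_
        have hS : ∀ y ∈ xs, y ∈ (Algebra.adjoin k {x | x ∈ xs}).toSubring :=
          fun y hy => Algebra.subset_adjoin hy
        exact grobner_mem_subring (S := (Algebra.adjoin k {x | x ∈ xs}).toSubring) ν xs hS
          fun c => fundamentalQSym_mem_subring _ _ hS

/-- At fixed length the lexicographic order is well founded: strong induction on the head inside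
induction on the length. -/
theorem lex_induction (n : ℕ) {P : List ℕ → Prop}
    (H : ∀ ν : List ℕ, ν.length = n → (∀ μ : List ℕ, μ.length = n → μ < ν → P μ) → P ν)
    (ν : List ℕ) (hν : ν.length = n) : P ν := by
  induction n generalizing P ν with
  | zero =>
    refine H ν hν fun μ hμ hlt => ?_
    rw [length_eq_zero_iff.1 hμ, length_eq_zero_iff.1 hν] at hlt
    exact absurd hlt (lt_irrefl _)
  | succ n ih =>
    cases ν with
    | nil => simp at hν
    | cons b ν =>
      induction b using Nat.strong_induction_on generalizing ν with
      | _ b ihb =>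
        refine ih (P := fun ν => P (b :: ν)) (fun ν hν hlt => ?_) ν (by simpa using hν)
        refine H _ (by simpa using hν) fun μ hμ hμν => ?_
        cases μ with
        | nil => simp at hμ
        | cons a μ =>
          rcases List.cons_lt_cons_iff.1 hμν with h | ⟨rfl, h⟩
          · exact ihb a h μ hμ
          · exact hlt μ (by simpa using hμ) h

/-- Modulo an ideal containing the quasi-symmetric functions without constant term, every
monomial is a combination of monomials under the diagonal. -/
theorem mon_mem_of_not_transDiag {I : Ideal R} {xs : List R}
    (H : ∀ a K, monomialQSym (a :: K) xs ∈ I) {S : Submodule k R} (hI : ∀ y ∈ I, y ∈ S)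
    (hS : ∀ μ : List ℕ, μ.length = xs.length → ¬ TransDiag 0 μ → mon μ xs ∈ S)
    (ν : List ℕ) (hν : ν.length = xs.length) : mon ν xs ∈ S := by
  refine lex_induction xs.length (P := fun ν => mon ν xs ∈ S) (fun ν hν ih => ?_) ν hν
  by_cases ht : TransDiag 0 ν
  · have h₁ : grobner ν xs (fun c => fundamentalQSym c xs) ∈ S := by
      refine hI _ (grobner_mem ν xs (fun c hc => ?_) ht hν)
      -- At threshold 0 the only excluded index is the empty composition, that is, the constant 1.
      cases c with
      | nil => exact hc.elim
      | cons a c => exact fundamentalQSym_mem H a c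
    have h₂ : lexLower k ν xs ≤ S := by
      refine Submodule.span_le.2 ?_
      rintro _ ⟨μ, hμ, hlt, rfl⟩
      exact ih μ hμ hlt
    have := S.sub_mem h₁ (h₂ (grobner_sub_mon_mem_lexLower k ν xs hν))
    simpa using this
  · exact hS ν hν ht

end Quasisymmetric
end QuasiInv

namespace QuasiInv
open List

/-! ### Functionals annihilating the ideal, by transposed divided differences. -/

section Dual

variable {k : Type*} [CommRing k]

/-- The sum of `h` over all exponents obtained from `μ` by adding the parts of a composition at
increasing positions; the entry `a` of the indexing list encodes the part `a + 1`. -/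
def placeSum : List ℕ → List ℕ → (List ℕ → k) → k
  | [], μ, h => h μ
  | _ :: _, [], _ => 0
  | b :: K, a :: μ, h =>
    placeSum (b :: K) μ (fun l => h (a :: l)) + placeSum K μ (fun l => h ((a + b + 1) :: l))

/-- The transpose of the quasi-symmetric divided difference at the first two positions. -/
def trimHead (h : List ℕ → k) : List ℕ → k
  | (a + 1) :: 0 :: β => h (a :: β)
  | 0 :: (b + 1) :: β => -h (b :: β)
  | _ => 0

/-- The transpose of the quasi-symmetric divided difference at positions `i`, `i + 1`. -/
def trim : ℕ → (List ℕ → k) → List ℕ → k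
  | 0, h, μ => trimHead h μ
  | i + 1, h, a :: μ => trim i (fun l => h (a :: l)) μ
  | _ + 1, _, [] => 0

/-- A function of exponents of length `n`, seen as a functional on polynomials, vanishes on the
ideal generated by the quasi-symmetric polynomials without constant term. -/
def Annihilates (n : ℕ) (h : List ℕ → k) : Prop :=
  ∀ (b : ℕ) (K μ : List ℕ), μ.length = n → placeSum (b :: K) μ h = 0

theorem placeSum_zero (K μ : List ℕ) : placeSum K μ (fun _ => (0 : k)) = 0 := by
  induction μ generalizing K with
  | nil => cases K <;> rfl
  | cons a μ ih => cases K <;> simp [placeSum, ih]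

theorem placeSum_neg (K μ : List ℕ) (h : List ℕ → k) :
    placeSum K μ (fun l => -h l) = -placeSum K μ h := by
  induction μ generalizing K h with
  | nil => cases K <;> simp [placeSum]
  | cons a μ ih => cases K <;> simp [placeSum, ih, add_comm]

theorem trimHead_add (h₁ h₂ : List ℕ → k) (μ : List ℕ) :
    trimHead (fun l => h₁ l + h₂ l) μ = trimHead h₁ μ + trimHead h₂ μ := by
  rcases μ with _ | ⟨_ | a, _ | ⟨_ | b, μ⟩⟩ <;> simp [trimHead, add_comm]

theorem trim_add (i : ℕ) (h₁ h₂ : List ℕ → k) (μ : List ℕ) :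
    trim i (fun l => h₁ l + h₂ l) μ = trim i h₁ μ + trim i h₂ μ := by
  induction i generalizing h₁ h₂ μ with
  | zero => exact trimHead_add h₁ h₂ μ
  | succ i ih => cases μ <;> simp [trim, ih]

theorem trim_eq_zero (i n : ℕ) {h : List ℕ → k} (H : ∀ μ : List ℕ, μ.length = n → h μ = 0)
    (μ : List ℕ) (hμ : μ.length = n + 1) : trim i h μ = 0 := by
  induction i generalizing h μ n with
  | zero =>
    rcases μ with _ | ⟨_ | a, _ | ⟨_ | b, μ⟩⟩ <;>
      simp_all [trim, trimHead]
  | succ i ih =>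
    cases μ with
    | nil => rfl
    | cons a μ =>
      cases n with
      | zero =>
        have : μ = [] := by simpa using hμ
        subst this
        cases i <;> rfl
      | succ n => exact ih n (fun l hl => H _ (by simpa using hl)) μ (by simpa using hμ)

theorem placeSum_trimHead (K : List ℕ) (a b : ℕ) (β : List ℕ) (h : List ℕ → k) :
    placeSum K (a :: b :: β) (trimHead h) = trimHead (fun l => placeSum K l h) (a :: b :: β) := by
  rcases K with _ | ⟨c, K⟩
  · rcases a with _ | a <;> rcases b with _ | b <;> simp [trimHead, placeSum]
  · rcases K with _ | ⟨d, K⟩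
    · rcases a with _ | a <;> rcases b with _ | b <;>
        simp [trimHead, placeSum, placeSum_zero, placeSum_neg, Nat.add_right_comm _ 1 c]
      ring
    · rcases a with _ | a <;> rcases b with _ | b <;>
        simp [trimHead, placeSum, placeSum_zero, placeSum_neg, Nat.add_right_comm _ 1 c]
      ring

/-- The transpose of the fact that the divided difference is linear over quasi-symmetric functions:
applied to `x^μ` times a monomial quasi-symmetric function, it acts on `x^μ` only, and the other
factor loses one variable. -/
theorem placeSum_trim (i : ℕ) (K μ : List ℕ) (hμ : i + 2 ≤ μ.length) (h : List ℕ → k) :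
    placeSum K μ (trim i h) = trim i (fun l => placeSum K l h) μ := by
  induction i generalizing K μ h with
  | zero =>
    rcases μ with _ | ⟨a, _ | ⟨b, β⟩⟩
    · simp at hμ
    · simp at hμ
    · exact placeSum_trimHead K a b β h
  | succ i ih =>
    rcases μ with _ | ⟨a, μ⟩
    · simp at hμ
    · have hμ' : i + 2 ≤ μ.length := by simpa using hμ
      rcases K with _ | ⟨b, K⟩
      · rfl
      · simp only [placeSum, trim, ih _ _ hμ', trim_add]

theorem Annihilates.trim {n i : ℕ} {h : List ℕ → k} (H : Annihilates n h) (hi : i + 1 ≤ n) :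
    Annihilates (n + 1) (fun μ => -trim i h μ) := by
  intro b K μ hμ
  rw [placeSum_neg, placeSum_trim i _ _ (by omega), trim_eq_zero i n (H b K) μ hμ, neg_zero]

/-- A degree argument: every part placed adds at least one to the sum of `μ`. -/
theorem placeSum_eq_zero_of_sum_lt (K μ : List ℕ) (N : ℕ) (h : List ℕ → k)
    (H : ∀ l : List ℕ, N < l.sum → h l = 0) (hK : N < μ.sum + K.length) :
    placeSum K μ h = 0 := by
  induction μ generalizing K N h with
  | nil =>
    cases K with
    | nil => exact H _ (by simp at hK)
    | cons b K => rfl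
  | cons a μ ih =>
    cases K with
    | nil => exact H _ (by simpa using hK)
    | cons b K =>
      simp only [sum_cons, length_cons] at hK
      by_cases ha : a + b + 1 ≤ N
      · rw [placeSum, ih _ (N - a) _ (fun l hl => H _ (by simp; omega)) (by simp; omega),
          ih _ (N - (a + b + 1)) _ (fun l hl => H _ (by simp; omega)) (by omega), add_zero]
      · have h₂ : (fun l => h ((a + b + 1) :: l)) = fun _ => 0 :=
          funext fun l => H _ (by simp; omega)
        rw [placeSum, h₂, placeSum_zero, add_zero]
        by_cases ha' : a ≤ N
        · exact ih _ (N - a) _ (fun l hl => H _ (by simp; omega)) (by simp; omega)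
        · have h₁ : (fun l => h (a :: l)) = fun _ => 0 := funext fun l => H _ (by simp; omega)
          rw [h₁, placeSum_zero]

theorem annihilates_const (n : ℕ) :
    Annihilates n (fun μ => if μ.sum = 0 then (1 : k) else 0) := by
  intro b K μ _
  exact placeSum_eq_zero_of_sum_lt _ _ 0 _ (fun l hl => if_neg (by omega)) (by simp)

theorem trim_replicate (i b : ℕ) (β : List ℕ) (h : List ℕ → k) :
    trim i h (replicate i 0 ++ 0 :: (b + 1) :: β) = -h (replicate i 0 ++ b :: β) := by
  induction i generalizing h with
  | zero => rfl
  | succ i ih => simp [replicate_succ, trim, ih]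

theorem cons_le_cons_iff_of_nat (a b : ℕ) (μ ν : List ℕ) :
    a :: μ ≤ b :: ν ↔ a < b ∨ a = b ∧ μ ≤ ν := by
  rw [← not_lt, ← not_lt (a := ν), cons_lt_cons_iff]
  grind

/-- Each value of `trim i h` is zero or, up to sign, a single value of `h`, at the exponent with a
zero deleted and its neighbour lowered by one. This correspondence carries lower bounds on the
support from `h` to `trim i h`. -/
theorem exists_of_trim_ne_zero (i b : ℕ) (β : List ℕ) (h : List ℕ → k) (μ : List ℕ)
    (hμ : trim i h μ ≠ 0) :
    ∃ l : List ℕ, h l ≠ 0 ∧ μ.length = l.length + 1 ∧ μ.sum = l.sum + 1 ∧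
      (replicate i 0 ++ b :: β ≤ l → replicate i 0 ++ 0 :: (b + 1) :: β ≤ μ) := by
  induction i generalizing h μ with
  | zero =>
    rcases μ with _ | ⟨_ | a, _ | ⟨_ | c, μ⟩⟩ <;>
      simp only [trim, trimHead, ne_eq, not_true_eq_false, neg_eq_zero] at hμ
    · refine ⟨_, hμ, by simp, by simp; omega, fun hle => ?_⟩
      simp only [replicate_zero, nil_append, cons_le_cons_iff_of_nat] at hle ⊢
      grind
    · refine ⟨_, hμ, by simp, by simp; omega, fun hle => ?_⟩
      simp only [replicate_zero, nil_append, cons_le_cons_iff_of_nat] at hle ⊢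
      grind
  | succ i ih =>
    rcases μ with _ | ⟨a, μ⟩
    · exact absurd rfl hμ
    · obtain ⟨l, h₁, h₂, h₃, h₄⟩ := ih _ μ hμ
      refine ⟨a :: l, h₁, by simp [h₂], by simp [h₃]; omega, fun hle => ?_⟩
      simp only [replicate_succ, cons_append, cons_le_cons_iff_of_nat] at hle ⊢
      grind

/-- Locate the first nonzero entry; deleting the zero before it and lowering it by one stays under
the diagonal. The middle alternative, a nonzero head, is there for the induction and cannot occur at
`d = 0`. -/
theorem eq_replicate_or_of_not_transDiag (d : ℕ) (ν : List ℕ) (hν : ¬ TransDiag d ν) :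
    ν = replicate ν.length 0 ∨
      (∃ b β, ν = (b + 1) :: β ∧ b + 1 ≤ d ∧ ¬ TransDiag (d - b) β) ∨
      ∃ i b β, ν = replicate i 0 ++ 0 :: (b + 1) :: β ∧
        ¬ TransDiag d (replicate i 0 ++ b :: β) := by
  induction ν generalizing d with
  | nil => exact Or.inl rfl
  | cons a ν ih =>
    simp only [TransDiag, not_or, not_lt] at hν
    rcases a with _ | a
    · rcases ih (d + 1) (by simpa using hν.2) with h | ⟨b, β, rfl, hb, h⟩ | ⟨i, b, β, rfl, h⟩
      · exact Or.inl (by rw [length_cons, replicate_succ, ← h])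
      · refine Or.inr (Or.inr ⟨0, b, β, rfl, ?_⟩)
        rintro (h' | h')
        · omega
        · exact h h'
      · refine Or.inr (Or.inr ⟨i + 1, b, β, rfl, ?_⟩)
        rintro (h' | h')
        · omega
        · exact h h'
    · refine Or.inr (Or.inl ⟨a, ν, rfl, hν.1, ?_⟩)
      convert hν.2 using 2
      omega

/-- A functional vanishing on the ideal of quasi-symmetric polynomials without constant term,
with leading exponent a given one under the diagonal. -/
theorem exists_annihilates (ν : List ℕ) (hν : ¬ TransDiag 0 ν) :
    ∃ ψ : List ℕ → k, Annihilates ν.length ψ ∧ ψ ν = 1 ∧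
      ∀ μ : List ℕ, μ.length = ν.length → ψ μ ≠ 0 → ν ≤ μ ∧ μ.sum = ν.sum := by
  induction hn : ν.length generalizing ν with
  | zero =>
    rw [length_eq_zero_iff] at hn
    subst hn
    refine ⟨_, annihilates_const 0, by simp, fun μ hμ _ => ?_⟩
    rw [length_eq_zero_iff] at hμ
    subst hμ
    exact ⟨le_rfl, rfl⟩
  | succ n ih =>
    rcases eq_replicate_or_of_not_transDiag 0 ν hν with h | ⟨b, β, -, hb, -⟩ | ⟨i, b, β, rfl, h⟩
    · have hs : ν.sum = 0 := by rw [h]; simp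
      refine ⟨_, annihilates_const _, if_pos hs, fun μ hμ hne => ?_⟩
      have hμs : μ.sum = 0 := by
        by_contra hc
        exact hne (if_neg hc)
      have : μ = ν := by
        rw [h, hn, eq_replicate_iff]
        exact ⟨hμ, fun b hb => sum_eq_zero_iff.1 hμs b hb⟩
      exact ⟨this.ge, by rw [this]⟩
    · omega
    · simp only [length_append, length_replicate, length_cons] at hn
      obtain ⟨ψ, h₁, h₂, h₃⟩ := ih _ h (by simp; omega)
      -- The sign in `Annihilates.trim` cancels the one in `trim_replicate`, so the value at the
      -- leading exponent stays 1.
      refine ⟨_, h₁.trim (i := i) (by omega), by rw [trim_replicate, h₂, neg_neg],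
        fun μ hμ hne => ?_⟩
      obtain ⟨l, hl, hlen, hsum, hle⟩ :=
        exists_of_trim_ne_zero i b β ψ μ (fun h0 => hne (by rw [h0, neg_zero]))
      obtain ⟨h₄, h₅⟩ := h₃ l (by omega) hl
      refine ⟨hle h₄, ?_⟩
      simp only [sum_append, sum_cons] at h₅ ⊢
      omega

end Dual

/-! ### Counting exponents under the diagonal by ballot numbers. -/

section Count

/-- The exponents `ν` of length `n` all of whose initial segments of length `j ≥ 1` have sum less
than `j + d`. -/
def underDiag : ℕ → ℕ → List (List ℕ)
  | 0, _ => [[]]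
  | n + 1, d => (range (d + 1)).flatMap fun b => (underDiag n (d + 1 - b)).map (b :: ·)

theorem mem_underDiag (n d : ℕ) (ν : List ℕ) :
    ν ∈ underDiag n d ↔ ν.length = n ∧ ¬ TransDiag d ν := by
  induction n generalizing d ν with
  | zero => cases ν <;> simp [underDiag, TransDiag]
  | succ n ih =>
    cases ν with
    | nil => simp [underDiag]
    | cons b ν =>
      simp only [underDiag, mem_flatMap, mem_range, mem_map, ih, TransDiag, length_cons, cons.injEq]
      constructor
      · rintro ⟨b, hb, ν, ⟨h₁, h₂⟩, rfl, rfl⟩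
        exact ⟨by omega, by rintro (h | h); omega; exact h₂ h⟩
      · rintro ⟨h₁, h₂⟩
        exact ⟨b, by by_contra h; exact h₂ (Or.inl (by omega)), ν,
          ⟨by omega, fun h => h₂ (Or.inr h)⟩, rfl, rfl⟩

theorem nodup_underDiag (n d : ℕ) : (underDiag n d).Nodup := by
  induction n generalizing d with
  | zero => simp [underDiag]
  | succ n ih =>
    rw [underDiag, nodup_flatMap]
    refine ⟨fun b _ => (ih _).map fun _ _ h => (cons.inj h).2, ?_⟩
    refine (nodup_range).imp fun {b c} hbc => ?_
    intro l hb hc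
    obtain ⟨_, _, rfl⟩ := mem_map.1 hb
    obtain ⟨_, _, h⟩ := mem_map.1 hc
    exact hbc (cons.inj h).1.symm

theorem length_underDiag_succ (n d : ℕ) :
    (underDiag (n + 1) d).length = ∑ b ∈ Finset.range (d + 1), (underDiag n (b + 1)).length := by
  have hsum (N : ℕ) (f : ℕ → ℕ) : ((range N).map f).sum = ∑ b ∈ Finset.range N, f b := by
    induction N with
    | zero => rfl
    | succ N ih => simp [range_succ, Finset.sum_range_succ, ih]
  rw [underDiag, length_flatMap, hsum, ← Finset.sum_range_reflect]
  refine Finset.sum_congr rfl fun b hb => ?_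
  have := Finset.mem_range.1 hb
  rw [length_map]
  congr 2
  omega

/-- The ballot number formula, written additively. Splitting off the last term of the sum gives the
recursion `N(n+1, d+1) = N(n+1, d) + N(n, d+2)`, which both binomials satisfy by Pascal's rule; the
boundary `d = 0` also uses the symmetry of the middle binomials. -/
theorem length_underDiag (n d : ℕ) :
    (underDiag (n + 1) d).length + (2 * (n + 1) + d).choose n =
      (2 * (n + 1) + d).choose (n + 1) := by
  induction n generalizing d with
  | zero => simp [underDiag]; omega
  | succ n ih =>
    induction d with
    | zero =>
      have h := ih 1
      have h₁ := Nat.choose_succ_succ (2 * (n + 1) + 1) n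
      have h₂ := Nat.choose_succ_succ (2 * (n + 1) + 1) (n + 1)
      have h₃ := Nat.choose_symm_half (n + 1)
      rw [length_underDiag_succ]
      simp only [Finset.sum_range_one, zero_add, add_zero]
      have e : 2 * (n + 1 + 1) = 2 * (n + 1) + 1 + 1 := by ring
      rw [e]
      simp only [Nat.succ_eq_add_one] at *
      omega
    | succ d ihd =>
      rw [length_underDiag_succ, Finset.sum_range_succ, ← length_underDiag_succ]
      have h := ih (d + 1 + 1)
      have e : 2 * (n + 1 + 1) + (d + 1) = 2 * (n + 1 + 1) + d + 1 := by ring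
      have e' : 2 * (n + 1) + (d + 1 + 1) = 2 * (n + 1 + 1) + d := by ring
      have h₁ := Nat.choose_succ_succ (2 * (n + 1 + 1) + d) n
      have h₂ := Nat.choose_succ_succ (2 * (n + 1 + 1) + d) (n + 1)
      rw [e]
      rw [e'] at h
      simp only [Nat.succ_eq_add_one] at *
      omega

theorem length_underDiag_zero (n : ℕ) : (underDiag n 0).length = catalan n := by
  cases n with
  | zero => simp [underDiag]
  | succ n =>
    have h := length_underDiag n 0
    have h₁ := succ_mul_catalan_eq_centralBinom (n + 1)
    have h₃ := Nat.choose_succ_right_eq (2 * (n + 1)) n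
    rw [Nat.centralBinom] at h₁
    simp only [add_zero] at h
    have e : 2 * (n + 1) - n = n + 2 := by omega
    rw [e] at h₃
    refine Nat.eq_of_mul_eq_mul_left (Nat.succ_pos (n + 1)) ?_
    rw [Nat.succ_eq_add_one, h₁]
    nlinarith

end Count
end QuasiInv

namespace QuasiInv
open List

noncomputable section

/-! ### Quasi-invariance as a condition on coefficients. -/

section Exponents

variable {n m : ℕ}

/-- The list of the nonzero exponents. -/
def nonzeroExps (ν : Fin n →₀ ℕ) : List ℕ := (List.ofFn ν).filter (· ≠ 0)

theorem filter_finRange_mem (B : Finset (Fin n)) (c : ℕ) (hc : B.card = c) :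
    (finRange n).filter (· ∈ B) = List.ofFn (B.orderEmbOfFin hc) := by
  refine SortedLT.eq_of_mem_iff ?_ ?_ fun i => ?_
  · exact ((sortedLT_finRange n).pairwise.filter _).sortedLT
  · exact sortedLT_ofFn_iff.2 (B.orderEmbOfFin hc).strictMono
  · have := B.range_orderEmbOfFin hc
    rw [mem_filter, List.mem_ofFn, ← Set.mem_range, this]
    simp

theorem nonzeroExps_eq_ofFn (ν : Fin n →₀ ℕ) (B : Finset (Fin n)) (hB : ν.support = B) (c : ℕ)
    (hc : B.card = c) : nonzeroExps ν = List.ofFn fun r => ν (B.orderEmbOfFin hc r) := by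
  have : List.ofFn (fun r => ν (B.orderEmbOfFin hc r)) =
      (List.ofFn (B.orderEmbOfFin hc)).map ν := by rw [map_ofFn]; rfl
  rw [this, ← filter_finRange_mem, nonzeroExps, ofFn_eq_map, List.filter_map]
  congr 2
  funext i
  simp [← hB]

theorem eq_of_nonzeroExps_eq {ν ν' : Fin n →₀ ℕ} (hs : ν.support = ν'.support)
    (h : nonzeroExps ν = nonzeroExps ν') : ν = ν' := by
  rw [nonzeroExps_eq_ofFn ν _ hs _ rfl, nonzeroExps_eq_ofFn ν' _ rfl _ rfl] at h
  have h := List.ofFn_injective h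
  ext i
  by_cases hi : i ∈ ν'.support
  · rw [← Finset.mem_coe, ← Finset.range_orderEmbOfFin _ rfl] at hi
    obtain ⟨r, rfl⟩ := hi
    exact congrFun h r
  · rw [Finsupp.notMem_support_iff.1 hi, Finsupp.notMem_support_iff.1 (hs ▸ hi)]

theorem sum_single_orderEmbOfFin (B : Finset (Fin n)) {c : ℕ} (hc : B.card = c) (f : Fin c → ℕ)
    (r : Fin c) :
    (∑ r, Finsupp.single (B.orderEmbOfFin hc r) (f r) : Fin n →₀ ℕ) (B.orderEmbOfFin hc r) =
      f r := by
  rw [Finsupp.finsetSum_apply, Finset.sum_eq_single r]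
  · simp
  · intro s _ hs
    exact Finsupp.single_eq_of_ne fun h => hs ((B.orderEmbOfFin hc).injective h.symm)
  · simp

theorem card_moveVars (g : GenSymm n m) (A : Finset (Fin n)) : (moveVars g A).card = A.card :=
  Finset.card_map _

theorem moveExp_eq_sum (g : GenSymm n m) (ν : Fin n →₀ ℕ) :
    moveExp g ν = ∑ r, Finsupp.single
      ((moveVars g ν.support).orderEmbOfFin (card_moveVars g ν.support) r)
      (ν (ν.support.orderEmbOfFin rfl r)) :=
  rfl

theorem mem_moveVars_iff (g : GenSymm n m) (A : Finset (Fin n)) (i : Fin n) :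
    i ∈ moveVars g A ↔ g.right i ∈ A := by
  rw [moveVars, Finset.mem_map]
  constructor
  · rintro ⟨j, hj, rfl⟩
    simpa using hj
  · exact fun h => ⟨_, h, by simp⟩

theorem support_moveExp (g : GenSymm n m) (ν : Fin n →₀ ℕ) :
    (moveExp g ν).support = moveVars g ν.support := by
  ext i
  by_cases hi : i ∈ moveVars g ν.support
  · refine iff_of_true ?_ hi
    rw [← Finset.mem_coe, ← Finset.range_orderEmbOfFin (moveVars g ν.support)
      (card_moveVars g _)] at hi
    obtain ⟨r, rfl⟩ := hi
    rw [Finsupp.mem_support_iff, moveExp_eq_sum, sum_single_orderEmbOfFin]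
    exact Finsupp.mem_support_iff.1 (Finset.orderEmbOfFin_mem _ _ _)
  · refine iff_of_false (fun h => hi ?_) hi
    rw [Finsupp.mem_support_iff, moveExp_eq_sum, Finsupp.finsetSum_apply] at h
    obtain ⟨r, -, hr⟩ := Finset.exists_ne_zero_of_sum_ne_zero h
    have := (Finsupp.single_apply_ne_zero.1 hr).1
    rw [this]
    exact Finset.orderEmbOfFin_mem _ _ _

theorem nonzeroExps_moveExp (g : GenSymm n m) (ν : Fin n →₀ ℕ) :
    nonzeroExps (moveExp g ν) = nonzeroExps ν := by
  rw [nonzeroExps_eq_ofFn _ _ (support_moveExp g ν) _ (card_moveVars g _),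
    nonzeroExps_eq_ofFn ν _ rfl _ rfl]
  congr 1
  funext r
  rw [moveExp_eq_sum]
  exact sum_single_orderEmbOfFin _ _ _ _

theorem moveExp_moveExp_inv (g : GenSymm n m) (ν : Fin n →₀ ℕ) :
    moveExp g (moveExp g⁻¹ ν) = ν := by
  refine eq_of_nonzeroExps_eq ?_ (by rw [nonzeroExps_moveExp, nonzeroExps_moveExp])
  rw [support_moveExp, support_moveExp]
  ext i
  simp only [mem_moveVars_iff, SemidirectProduct.inv_right]
  simp

theorem moveExp_injective (g : GenSymm n m) : Function.Injective (moveExp g) := by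
  refine Function.LeftInverse.injective (g := moveExp g⁻¹) fun ν => ?_
  simpa using moveExp_moveExp_inv g⁻¹ ν

theorem exists_moveExp_eq {ν ν' : Fin n →₀ ℕ} (h : nonzeroExps ν = nonzeroExps ν') :
    ∃ g : GenSymm n m, moveExp g ν = ν' := by
  have hcard : ν.support.card = ν'.support.card := by
    have := congrArg List.length h
    rwa [nonzeroExps_eq_ofFn ν _ rfl _ rfl, nonzeroExps_eq_ofFn ν' _ rfl _ rfl, length_ofFn,
      length_ofFn] at this
  -- Any permutation carrying one support onto the other will do; it enters inverted because
  -- `moveVars` uses `g.right⁻¹`.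
  let e := (Finset.equivOfCardEq hcard).extendSubtype
  refine ⟨⟨1, e⁻¹⟩, eq_of_nonzeroExps_eq ?_ (by rw [nonzeroExps_moveExp, h])⟩
  rw [support_moveExp]
  refine Finset.eq_of_subset_of_card_le (fun i hi => ?_) (by simp [moveVars, hcard])
  obtain ⟨j, hj, rfl⟩ := Finset.mem_map.1 hi
  simp only [inv_inv, Equiv.coe_toEmbedding]
  exact Equiv.extendSubtype_mem _ j hj

theorem forall_dvd_iff (ν : Fin n →₀ ℕ) : (∀ i, m ∣ ν i) ↔ ∀ a ∈ nonzeroExps ν, m ∣ a := by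
  simp only [nonzeroExps, mem_filter, List.mem_ofFn]
  constructor
  · rintro h a ⟨⟨i, rfl⟩, -⟩
    exact h i
  · intro h i
    by_cases hi : ν i = 0
    · simp [hi]
    · exact h _ ⟨⟨i, rfl⟩, by simpa using hi⟩

theorem cExp_eq_zero_iff (ν : Fin n →₀ ℕ) : cExp m ν = 0 ↔ ∀ i, m ∣ ν i := by
  have : (∀ i ∈ ν.support, ν i ≡ 0 [MOD m]) ↔ ∀ i, m ∣ ν i := by
    simp only [Nat.modEq_zero_iff_dvd]
    refine ⟨fun h i => ?_, fun h i _ => h i⟩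
    by_cases hi : i ∈ ν.support
    · exact h i hi
    · simp [Finsupp.notMem_support_iff.1 hi]
  rw [← this, cExp]
  by_cases h : ∀ i ∈ ν.support, ν i ≡ 0 [MOD m]
  · rw [if_pos h]
    exact iff_of_true rfl h
  · rw [if_neg h]
    exact iff_of_false one_ne_zero h

theorem coeff_quasiAct (g : GenSymm n m) (P : MvPolynomial (Fin n) ℂ) (ν : Fin n →₀ ℕ) :
    coeff (moveExp g ν) (quasiAct g P) = weight g ^ cExp m ν * coeff ν P := by
  induction P using MvPolynomial.induction_on' with
  | monomial μ a =>
    have : quasiAct g (monomial μ a) = a • monomial (moveExp g μ) (weight g ^ cExp m μ) := by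
      have h : monomial μ a = a • basisMonomials (Fin n) ℂ μ := by simp [smul_monomial]
      rw [h, map_smul, quasiAct, Module.Basis.constr_basis]
    rw [this, coeff_smul, coeff_monomial, coeff_monomial]
    by_cases h : μ = ν
    · rw [if_pos (by rw [h]), if_pos h, h, smul_eq_mul, mul_comm]
    · rw [if_neg ((moveExp_injective g).ne h), if_neg h, smul_zero, mul_zero]
  | add P Q hP hQ => rw [map_add, coeff_add, hP, hQ, coeff_add, mul_add]

/-- Diagonal elements fix every exponent and rescale those with `cExp = 1`, so these must vanish. On
the others the action only relocates the list of nonzero exponents, transitively among supports of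
equal size. -/
theorem mem_QInv_iff (hm : 1 ≤ m) (P : MvPolynomial (Fin n) ℂ) :
    P ∈ QInv n m ↔ (∀ ν, ¬ (∀ i, m ∣ ν i) → coeff ν P = 0) ∧
      ∀ ν ν', (∀ i, m ∣ ν i) → nonzeroExps ν = nonzeroExps ν' → coeff ν P = coeff ν' P := by
  constructor
  · intro hP
    have key (g : GenSymm n m) (ν) : coeff (moveExp g ν) P = weight g ^ cExp m ν * coeff ν P := by
      rw [← coeff_quasiAct, hP g]
    refine ⟨fun ν hν => ?_, fun ν ν' hν h => ?_⟩
    · obtain ⟨i, hi⟩ := not_forall.1 hν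
      have hm1 : m ≠ 1 := by
        rintro rfl
        exact hi (one_dvd _)
      have : NeZero m := ⟨by omega⟩
      have hprim := Complex.isPrimitiveRoot_exp m (by omega)
      let ζ : rootsOfUnity m ℂ := hprim.toRootsOfUnity
      -- A diagonal matrix with one primitive root `ζ`: it moves no exponent and has weight `ζ ≠ 1`.
      let g : GenSymm n m := ⟨Pi.mulSingle i ζ, 1⟩
      have hw : weight g ≠ 1 := by
        have : weight g = ((ζ : ℂˣ) : ℂ) := by
          rw [weight, Finset.prod_eq_single i]
          · simp [g]
          · intro j _ hj
            simp [g, Pi.mulSingle_eq_of_ne hj]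
          · simp
        rw [this]
        have hζ : ((ζ : ℂˣ) : ℂ) = _ := hprim.val_toRootsOfUnity_coe
        rw [hζ]
        exact hprim.ne_one (by omega)
      have hmove : moveExp g ν = ν :=
        eq_of_nonzeroExps_eq (by rw [support_moveExp]; ext j; simp only [mem_moveVars_iff, g]; rfl)
          (nonzeroExps_moveExp g ν)
      have hc : cExp m ν = 1 := by
        have h0 := mt (cExp_eq_zero_iff (m := m) ν).1 hν
        rw [cExp] at h0 ⊢
        split_ifs at h0 ⊢ <;> simp_all
      have := key g ν
      rw [hmove, hc, pow_one] at this
      by_contra h0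
      exact hw (mul_right_cancel₀ h0 (by rw [← this, one_mul]))
    · obtain ⟨g, rfl⟩ := exists_moveExp_eq (m := m) h
      rw [key, (cExp_eq_zero_iff ν).2 hν, pow_zero, one_mul]
  · rintro ⟨h₁, h₂⟩ g
    ext ν'
    obtain ⟨ν, rfl⟩ : ∃ ν, moveExp g ν = ν' := ⟨_, moveExp_moveExp_inv g ν'⟩
    rw [coeff_quasiAct]
    by_cases hν : ∀ i, m ∣ ν i
    · rw [(cExp_eq_zero_iff ν).2 hν, pow_zero, one_mul]
      exact h₂ _ _ hν (nonzeroExps_moveExp g ν).symm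
    · rw [h₁ _ hν, h₁, mul_zero]
      rwa [forall_dvd_iff, nonzeroExps_moveExp, ← forall_dvd_iff]

/-- The composition of nonzero entries of a list, each encoded with a shift by one. -/
def compositionOf : List ℕ → List ℕ
  | [] => []
  | 0 :: l => compositionOf l
  | (a + 1) :: l => a :: compositionOf l

theorem compositionOf_map_div (hm : 1 ≤ m) (l : List ℕ) (hl : ∀ a ∈ l, m ∣ a) :
    (compositionOf (l.map (· / m))).map (fun a => m * (a + 1)) = l.filter (· ≠ 0) := by
  induction l with
  | nil => rfl
  | cons a l ih =>
    obtain ⟨c, rfl⟩ := hl a mem_cons_self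
    have ih := ih fun b hb => hl b (mem_cons_of_mem _ hb)
    rw [map_cons, Nat.mul_div_cancel_left c hm]
    cases c with
    | zero => simpa [compositionOf] using ih
    | succ c =>
      rw [compositionOf, map_cons, ih, filter_cons_of_pos]
      have : m ≠ 0 := by omega
      simp [this]

theorem map_nonzeroExps (hm : 1 ≤ m) (ν : Fin n →₀ ℕ) (hν : ∀ i, m ∣ ν i) :
    (compositionOf (List.ofFn fun i => ν i / m)).map (fun a => m * (a + 1)) =
      nonzeroExps ν := by
  have : (List.ofFn fun i => ν i / m) = (List.ofFn ν).map (· / m) := by rw [map_ofFn]; rfl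
  rw [this, compositionOf_map_div hm, nonzeroExps]
  intro a ha
  obtain ⟨i, rfl⟩ := List.mem_ofFn.1 ha
  exact hν i

theorem nonzeroExps_eq_iff (hm : 1 ≤ m) {ν ν' : Fin n →₀ ℕ} (hν : ∀ i, m ∣ ν i)
    (hν' : ∀ i, m ∣ ν' i) :
    nonzeroExps ν = nonzeroExps ν' ↔
      compositionOf (List.ofFn fun i => ν i / m) =
        compositionOf (List.ofFn fun i => ν' i / m) := by
  rw [← map_nonzeroExps hm ν hν, ← map_nonzeroExps hm ν' hν']
  refine (List.map_injective_iff.2 fun a b hab => ?_).eq_iff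
  have := Nat.eq_of_mul_eq_mul_left (by omega) hab
  omega

theorem compositionOf_eq_nil {l : List ℕ} : compositionOf l = [] ↔ l = replicate l.length 0 := by
  induction l with
  | nil => simp [compositionOf]
  | cons a l ih => cases a <;> simp [compositionOf, replicate_succ, ih]

end Exponents

/-! ### Linear functionals evaluated on monomial quasi-symmetric functions. -/

section Functionals

variable {k R : Type*} [CommRing k] [CommRing R] [Algebra k R]

theorem map_monomialQSym (L : R →ₗ[k] k) (xs : List R) (K μ : List ℕ)
    (hμ : μ.length = xs.length) (h : List ℕ → k)
    (H : ∀ l : List ℕ, l.length = xs.length → L (mon l xs) = h (zipWith (· + ·) μ l)) :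
    L (monomialQSym K xs) = placeSum K μ h := by
  induction xs generalizing K μ L h with
  | nil =>
    have : μ = [] := by simpa using hμ
    subst this
    cases K with
    | nil => exact H [] rfl
    | cons b K => exact map_zero L
  | cons x xs ih =>
    cases μ with
    | nil => simp at hμ
    | cons a μ =>
      have hμ' : μ.length = xs.length := by simpa using hμ
      cases K with
      | nil =>
        have := H (replicate (x :: xs).length 0) (by simp)
        rw [mon_replicate_zero] at this
        rw [monomialQSym, this, placeSum]
        congr 1
        rw [← hμ]
        generalize a :: μ = l
        induction l with
        | nil => rfl
        | cons b l ih => simp [replicate_succ, ih]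
      | cons b K =>
        rw [monomialQSym, map_add, placeSum]
        congr 1
        · refine ih L _ _ hμ' _ fun l hl => ?_
          have := H (0 :: l) (by simpa using hl)
          simpa [mon] using this
        · refine ih (L ∘ₗ LinearMap.mulLeft k (x ^ (b + 1))) _ _ hμ' _ fun l hl => ?_
          exact H ((b + 1) :: l) (by simpa using hl)

theorem map_monomialQSym_eq_zero (L : R →ₗ[k] k) (xs : List R) (K : List ℕ)
    (H : ∀ l : List ℕ, l.length = xs.length → L (mon l xs) = 0) :
    L (monomialQSym K xs) = 0 := by
  rw [map_monomialQSym L xs K (replicate xs.length 0) (by simp) (fun _ => 0) H, placeSum_zero]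

/-- Meant for coefficient functionals: the monomial with exponents `μ` occurs only in the function
indexed by its list of nonzero exponents, and there with coefficient 1. -/
theorem map_monomialQSym_of_delta (L : R →ₗ[k] k) (xs : List R) (K μ : List ℕ)
    (hμ : μ.length = xs.length)
    (H : ∀ l : List ℕ, l.length = xs.length → L (mon l xs) = if l = μ then 1 else 0) :
    L (monomialQSym K xs) = if compositionOf μ = K then 1 else 0 := by
  induction xs generalizing K μ L with
  | nil =>
    have : μ = [] := by simpa using hμ
    subst this
    cases K with
    | nil => simpa [mon, compositionOf, monomialQSym] using H [] rfl
    | cons b K => simp [monomialQSym, compositionOf]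
  | cons x xs ih =>
    cases K with
    | nil =>
      have := H (replicate (x :: xs).length 0) (by simp)
      rw [mon_replicate_zero] at this
      rw [monomialQSym, this]
      simp only [compositionOf_eq_nil, hμ, eq_comm (a := μ)]
    | cons b K =>
      cases μ with
      | nil => simp at hμ
      | cons a μ =>
        have hμ' : μ.length = xs.length := by simpa using hμ
        have e₁ (l : List ℕ) (hl : l.length = xs.length) :
            L (mon l xs) = if 0 = a ∧ l = μ then 1 else 0 := by
          have := H (0 :: l) (by simpa using hl)
          simpa [mon] using this
        have e₂ (l : List ℕ) (hl : l.length = xs.length) :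
            (L ∘ₗ LinearMap.mulLeft k (x ^ (b + 1))) (mon l xs) =
              if b + 1 = a ∧ l = μ then 1 else 0 := by
          have := H ((b + 1) :: l) (by simpa using hl)
          simpa [mon] using this
        rw [monomialQSym, map_add]
        change _ + (L ∘ₗ LinearMap.mulLeft k (x ^ (b + 1))) (monomialQSym K xs) = _
        cases a with
        | zero =>
          rw [map_monomialQSym_eq_zero _ xs K fun l hl => by rw [e₂ l hl]; simp, add_zero,
            ih L _ μ hμ' fun l hl => by rw [e₁ l hl]; simp, compositionOf]
        | succ a =>
          rw [map_monomialQSym_eq_zero _ xs _ fun l hl => by rw [e₁ l hl]; simp, zero_add,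
            compositionOf]
          by_cases hab : b = a
          · subst hab
            rw [ih _ _ μ hμ' fun l hl => by rw [e₂ l hl]; simp]
            simp
          · rw [map_monomialQSym_eq_zero _ xs _ fun l hl => by rw [e₂ l hl]; simp [hab]]
            simp [Ne.symm hab]

end Functionals
end
end QuasiInv

namespace QuasiInv
open List

noncomputable section

/-! ### Generators of the ideal, and functionals vanishing on it. -/

section Ideal

variable {n m : ℕ}

/-- The list of the `m`-th powers of the variables. -/
def powVars (n m : ℕ) : List (MvPolynomial (Fin n) ℂ) := List.ofFn fun i => X i ^ m

theorem length_powVars : (powVars n m).length = n := length_ofFn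

theorem mon_ofFn {R : Type*} [CommRing R] {n : ℕ} (f : Fin n → ℕ) (x : Fin n → R) :
    mon (List.ofFn f) (List.ofFn x) = ∏ i, x i ^ f i := by
  induction n with
  | zero => simp [mon]
  | succ n ih => rw [ofFn_succ, ofFn_succ, mon, ih, Fin.prod_univ_succ]

theorem mon_powVars (ν : Fin n →₀ ℕ) :
    mon (List.ofFn ν) (powVars n m) = monomial (m • ν) 1 := by
  rw [powVars, mon_ofFn, monomial_eq, Finsupp.prod_fintype _ _ fun i => pow_zero _]
  simp [← pow_mul]

theorem exists_ofFn_eq {l : List ℕ} (hl : l.length = n) :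
    ∃ ν : Fin n →₀ ℕ, List.ofFn ν = l := by
  subst hl
  exact ⟨Finsupp.equivFunOnFinite.symm l.get, by simp⟩

theorem coeff_monomialQSym (hm : 1 ≤ m) (ν : Fin n →₀ ℕ) (K : List ℕ) :
    coeff ν (monomialQSym K (powVars n m)) =
      if (∀ i, m ∣ ν i) ∧ compositionOf (List.ofFn fun i => ν i / m) = K then 1 else 0 := by
  by_cases hν : ∀ i, m ∣ ν i
  · simp only [hν, implies_true, true_and]
    refine map_monomialQSym_of_delta (lcoeff ℂ ν) _ K _ (by simp [length_powVars]) fun l hl => ?_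
    obtain ⟨μ, rfl⟩ := exists_ofFn_eq (hl.trans length_powVars)
    rw [mon_powVars, lcoeff_apply, coeff_monomial]
    refine if_congr ?_ rfl rfl
    rw [ofFn_inj]
    constructor
    · rintro rfl
      funext i
      simp [Nat.mul_div_cancel_left _ hm]
    · intro h
      ext i
      rw [Finsupp.smul_apply, congrFun h i, smul_eq_mul, Nat.mul_div_cancel' (hν i)]
  · rw [if_neg fun h => hν h.1]
    refine map_monomialQSym_eq_zero (lcoeff ℂ ν) _ K fun l hl => ?_
    obtain ⟨μ, rfl⟩ := exists_ofFn_eq (hl.trans length_powVars)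
    rw [mon_powVars, lcoeff_apply, coeff_monomial, if_neg]
    rintro rfl
    exact hν fun i => ⟨μ i, rfl⟩

theorem monomialQSym_mem_QInvPlus (hm : 1 ≤ m) (b : ℕ) (K : List ℕ) :
    monomialQSym (b :: K) (powVars n m) ∈ QInvPlus n m := by
  refine ⟨(mem_QInv_iff hm _).2 ⟨fun ν hν => ?_, fun ν ν' hν h => ?_⟩, ?_⟩
  · rw [coeff_monomialQSym hm, if_neg fun h => hν h.1]
  · have hν' : ∀ i, m ∣ ν' i := by rwa [forall_dvd_iff, ← h, ← forall_dvd_iff]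
    simp only [coeff_monomialQSym hm, hν, hν', (nonzeroExps_eq_iff hm hν hν').1 h]
  · rw [constantCoeff_eq, coeff_monomialQSym hm, if_neg]
    rintro ⟨-, h⟩
    have : compositionOf (List.ofFn fun i : Fin n => (0 : Fin n →₀ ℕ) i / m) = [] := by
      rw [compositionOf_eq_nil]
      simp
    rw [this] at h
    exact (List.cons_ne_nil _ _ h.symm)

theorem QInvPlus_subset_span (hm : 1 ≤ m) {P : MvPolynomial (Fin n) ℂ} (hP : P ∈ QInvPlus n m) :
    P ∈ Submodule.span ℂ {Q | ∃ b K, monomialQSym (b :: K) (powVars n m) = Q} := by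
  classical
  obtain ⟨h₁, h₂⟩ := (mem_QInv_iff hm P).1 hP.1
  let comp : (Fin n →₀ ℕ) → List ℕ := fun ν => compositionOf (List.ofFn fun i => ν i / m)
  have hdvd : ∀ ν ∈ P.support, ∀ i, m ∣ ν i := fun ν hν => by
    by_contra h
    exact mem_support_iff.1 hν (h₁ ν h)
  have hex : ∀ K : List ℕ, ∃ c : ℂ, ∀ ν, (∀ i, m ∣ ν i) → comp ν = K → coeff ν P = c := by
    intro K
    by_cases hK : ∃ ν, (∀ i, m ∣ ν i) ∧ comp ν = K
    · obtain ⟨ν, hν, rfl⟩ := hK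
      exact ⟨coeff ν P, fun ν' hν' h => h₂ _ _ hν' ((nonzeroExps_eq_iff hm hν' hν).2 h)⟩
    · exact ⟨0, fun ν hν h => (hK ⟨ν, hν, h⟩).elim⟩
  choose c hc using hex
  have hsum : P = ∑ K ∈ P.support.image comp, c K • monomialQSym K (powVars n m) := by
    ext ν
    simp only [coeff_sum, coeff_smul, coeff_monomialQSym hm, smul_eq_mul, mul_ite, mul_one,
      mul_zero]
    by_cases hν : ∀ i, m ∣ ν i
    · simp only [hν, implies_true, true_and]
      change _ = ∑ K ∈ _, if comp ν = K then _ else _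
      rw [Finset.sum_ite_eq]
      split_ifs with h
      · exact hc _ ν hν rfl
      · by_contra h0
        exact h (Finset.mem_image_of_mem _ (mem_support_iff.2 h0))
    · simp only [hν, false_and, if_false, Finset.sum_const_zero]
      exact h₁ ν hν
  rw [hsum]
  refine Submodule.sum_mem _ fun K hK => Submodule.smul_mem _ _ (Submodule.subset_span ?_)
  cases K with
  | cons b K => exact ⟨b, K, rfl⟩
  -- The empty composition can only come from the exponent 0, excluded by the vanishing constant
  -- term.
  | nil =>
    obtain ⟨ν, hν, h⟩ := Finset.mem_image.1 hK
    have h0 : ν = 0 := by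
      ext i
      have h := compositionOf_eq_nil.1 h
      rw [length_ofFn, ← List.ofFn_const, ofFn_inj] at h
      have h : ν i / m = 0 := congrFun h i
      rw [← Nat.mul_div_cancel' (hdvd ν hν i)]
      rw [h, mul_zero]
      rfl
    subst h0
    exact (mem_support_iff.1 hν hP.2).elim

/-- The functional on polynomials given by a function `ψ` on exponents, read off on the monomials
whose exponents have residues `r` modulo `m`. -/
def residueFunctional (r : Fin n → Fin m) (ψ : List ℕ → ℂ) : MvPolynomial (Fin n) ℂ →ₗ[ℂ] ℂ :=
  (basisMonomials (Fin n) ℂ).constr ℂ fun ν =>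
    if ∀ i, ν i % m = r i then ψ (List.ofFn fun i => ν i / m) else 0

theorem residueFunctional_monomial (r : Fin n → Fin m) (ψ : List ℕ → ℂ) (ν : Fin n →₀ ℕ) :
    residueFunctional r ψ (monomial ν 1) =
      if ∀ i, ν i % m = r i then ψ (List.ofFn fun i => ν i / m) else 0 := by
  have := (basisMonomials (Fin n) ℂ).constr_basis ℂ (fun ν : Fin n →₀ ℕ =>
    if ∀ i, ν i % m = r i then ψ (List.ofFn fun i => ν i / m) else 0) ν
  rwa [coe_basisMonomials] at this

theorem zipWith_add_ofFn (f g : Fin n → ℕ) :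
    zipWith (· + ·) (List.ofFn f) (List.ofFn g) = List.ofFn fun i => f i + g i := by
  induction n with
  | zero => simp
  | succ n ih => simp [ofFn_succ, ih]

theorem map_eq_zero_of_mem_quasiIdeal (L : MvPolynomial (Fin n) ℂ →ₗ[ℂ] ℂ)
    (H : ∀ ν, ∀ Q ∈ QInvPlus n m, L (monomial ν 1 * Q) = 0) {P : MvPolynomial (Fin n) ℂ}
    (hP : P ∈ quasiIdeal n m) : L P = 0 := by
  suffices ∀ S, L (S * P) = 0 by simpa using this 1
  rw [quasiIdeal] at hP
  induction hP using Submodule.span_induction with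
  | mem Q hQ =>
    intro S
    induction S using MvPolynomial.induction_on' with
    | monomial ν a =>
      have : monomial ν a = a • monomial ν (1 : ℂ) := by simp [smul_monomial]
      rw [this, smul_mul_assoc, map_smul, H ν Q hQ, smul_zero]
    | add S T hS hT => rw [add_mul, map_add, hS, hT, add_zero]
  | zero => simp
  | add S T _ _ hS hT => exact fun a => by rw [mul_add, map_add, hS, hT, add_zero]
  | smul b S _ ih => exact fun a => by rw [smul_eq_mul, ← mul_assoc, ih]

/-- Multiplying by `x_i^m` preserves residues and adds one to the `i`-th quotient, so on each
residue class the condition is the one satisfied by `ψ`. -/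
theorem residueFunctional_eq_zero (hm : 1 ≤ m) (r : Fin n → Fin m) {ψ : List ℕ → ℂ}
    (hψ : Annihilates n ψ) {P : MvPolynomial (Fin n) ℂ} (hP : P ∈ quasiIdeal n m) :
    residueFunctional r ψ P = 0 := by
  have h₁ (ν : Fin n →₀ ℕ) (b K) :
      residueFunctional r ψ (monomial ν 1 * monomialQSym (b :: K) (powVars n m)) = 0 := by
    have := map_monomialQSym (residueFunctional r ψ ∘ₗ LinearMap.mulLeft ℂ (monomial ν 1))
      (powVars n m) (b :: K) (List.ofFn fun i => ν i / m) (by simp [length_powVars])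
      (fun l => if ∀ i, ν i % m = r i then ψ l else 0) fun l hl => by
        obtain ⟨μ, rfl⟩ := exists_ofFn_eq (hl.trans length_powVars)
        rw [mon_powVars, LinearMap.comp_apply, LinearMap.mulLeft_apply, monomial_mul, one_mul,
          residueFunctional_monomial, zipWith_add_ofFn]
        simp [Nat.add_mul_div_left _ _ hm]
    refine this.trans ?_
    by_cases h : ∀ i, ν i % m = r i
    · simp only [h, implies_true, if_true]
      exact hψ _ _ _ length_ofFn
    · simp only [h, if_false]
      exact placeSum_zero _ _
  have h₂ (ν : Fin n →₀ ℕ) (Q) (hQ : Q ∈ QInvPlus n m) :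
      residueFunctional r ψ (monomial ν 1 * Q) = 0 := by
    have hle : Submodule.span ℂ {Q | ∃ b K, monomialQSym (b :: K) (powVars n m) = Q} ≤
        LinearMap.ker (residueFunctional r ψ ∘ₗ LinearMap.mulLeft ℂ (monomial ν 1)) := by
      rw [Submodule.span_le]
      rintro _ ⟨b, K, rfl⟩
      exact h₁ ν b K
    exact hle (QInvPlus_subset_span hm hQ)
  exact map_eq_zero_of_mem_quasiIdeal _ h₂ hP

end Ideal

/-! ### The scalar product and adjointness of multiplication and differentiation. -/

section Pairing

variable {n m : ℕ}

theorem pderiv_pow_monomial (i : Fin n) (a : ℕ) (μ : Fin n →₀ ℕ) (c : ℂ) :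
    (((pderiv i).toLinearMap : Module.End ℂ (MvPolynomial (Fin n) ℂ)) ^ a) (monomial μ c) =
      monomial (μ - Finsupp.single i a) (c * (μ i).descFactorial a) := by
  induction a with
  | zero => simp
  | succ a ih =>
    rw [pow_succ', Module.End.mul_apply, ih, Derivation.coeFn_coe, pderiv_monomial,
      tsub_tsub, ← Finsupp.single_add]
    congr 1
    rw [Nat.descFactorial_succ, Finsupp.tsub_apply, Finsupp.single_eq_same]
    push_cast
    ring

theorem prod_pderiv_pow_monomial (l : List (Fin n)) (hl : l.Nodup) (ν μ : Fin n →₀ ℕ) (c : ℂ) :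
    (l.map fun i => ((pderiv i).toLinearMap : Module.End ℂ (MvPolynomial (Fin n) ℂ)) ^ ν i).prod
      (monomial μ c) = monomial (μ - (l.map fun i => Finsupp.single i (ν i)).sum)
        (c * (l.map fun i => ((μ i).descFactorial (ν i) : ℂ)).prod) := by
  induction l with
  | nil => simp
  | cons i l ih =>
    rw [map_cons, prod_cons, Module.End.mul_apply, ih (nodup_cons.1 hl).2, pderiv_pow_monomial,
      tsub_tsub]
    have hi : ((l.map fun i => Finsupp.single i (ν i)).sum : Fin n →₀ ℕ) i = 0 := by
      have hi := (nodup_cons.1 hl).1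
      clear ih hl
      induction l with
      | nil => rfl
      | cons j l ih =>
        rw [mem_cons, not_or] at hi
        rw [map_cons, sum_cons, Finsupp.add_apply, ih hi.2, Finsupp.single_eq_of_ne hi.1]
    rw [Finsupp.tsub_apply, hi, map_cons, map_cons, sum_cons, prod_cons, add_comm]
    congr 1
    rw [tsub_zero]
    ring

theorem diffOp_monomial (ν μ : Fin n →₀ ℕ) :
    diffOp n (monomial ν 1) (monomial μ 1) =
      monomial (μ - ν) (∏ i, ((μ i).descFactorial (ν i) : ℂ)) := by
  have h := (basisMonomials (Fin n) ℂ).constr_basis ℂ (fun ν => (List.ofFn fun i : Fin n =>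
      ((pderiv i).toLinearMap : Module.End ℂ (MvPolynomial (Fin n) ℂ)) ^ ν i).prod) ν
  rw [coe_basisMonomials] at h
  rw [diffOp, h, ofFn_eq_map, prod_pderiv_pow_monomial _ (nodup_finRange n), one_mul]
  have h₁ : ((finRange n).map fun i => Finsupp.single i (ν i)).sum = ν := by
    rw [← ofFn_eq_map, List.sum_ofFn, Finsupp.univ_sum_single]
  rw [h₁, ← ofFn_eq_map, List.prod_ofFn]

/-- The product of the factorials of the exponents. -/
def expFactorial (ν : Fin n →₀ ℕ) : ℂ := ∏ i, ((ν i).factorial : ℂ)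

theorem expFactorial_ne_zero (ν : Fin n →₀ ℕ) : expFactorial ν ≠ 0 :=
  Finset.prod_ne_zero_iff.2 fun _ _ => Nat.cast_ne_zero.2 (Nat.factorial_ne_zero _)

theorem expFactorial_mul_coeff_diffOp_monomial (κ ν μ : Fin n →₀ ℕ) :
    expFactorial κ * coeff κ (diffOp n (monomial ν 1) (monomial μ 1)) =
      if κ + ν = μ then expFactorial μ else 0 := by
  rw [diffOp_monomial, coeff_monomial]
  by_cases h : κ + ν = μ
  · subst h
    rw [if_pos (add_tsub_cancel_right κ ν), if_pos rfl, expFactorial, expFactorial,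
      ← Finset.prod_mul_distrib]
    refine Finset.prod_congr rfl fun i _ => ?_
    have := Nat.factorial_mul_descFactorial (Nat.le_add_left (ν i) (κ i))
    rw [Nat.add_sub_cancel] at this
    exact_mod_cast this
  · rw [if_neg h]
    -- Truncated subtraction may give `κ` although `ν ≤ μ` fails; then some falling factorial
    -- vanishes.
    by_cases h' : μ - ν = κ
    · rw [if_pos h', mul_eq_zero]
      right
      have : ¬ ν ≤ μ := fun hle => h (by rw [← h', tsub_add_cancel_of_le hle])
      rw [Finsupp.le_def, not_forall] at this
      obtain ⟨i, hi⟩ := this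
      refine Finset.prod_eq_zero (Finset.mem_univ i) ?_
      rw [Nat.descFactorial_of_lt (not_le.1 hi), Nat.cast_zero]
    · rw [if_neg h', mul_zero]

/-- The scalar product as a bilinear map. -/
def pairingₗ (n : ℕ) :
    MvPolynomial (Fin n) ℂ →ₗ[ℂ] MvPolynomial (Fin n) ℂ →ₗ[ℂ] ℂ :=
  LinearMap.compr₂ (diffOp n) (lcoeff ℂ 0)

theorem pairingₗ_apply (P Q : MvPolynomial (Fin n) ℂ) : pairingₗ n P Q = pairing P Q := by
  rw [pairing, eval_zero]
  rfl

theorem pairing_monomial (ν μ : Fin n →₀ ℕ) :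
    pairing (monomial ν 1) (monomial μ (1 : ℂ)) = if ν = μ then expFactorial μ else 0 := by
  have := expFactorial_mul_coeff_diffOp_monomial 0 ν μ
  rw [zero_add] at this
  rw [← this, ← pairingₗ_apply]
  simp [expFactorial, pairingₗ]

theorem linearMap_ext₂ {f g : MvPolynomial (Fin n) ℂ →ₗ[ℂ] MvPolynomial (Fin n) ℂ →ₗ[ℂ] ℂ}
    (h : ∀ ν μ, f (monomial ν 1) (monomial μ 1) = g (monomial ν 1) (monomial μ 1)) : f = g := by
  refine (basisMonomials (Fin n) ℂ).ext fun ν => (basisMonomials (Fin n) ℂ).ext fun μ => ?_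
  simpa using h ν μ

theorem pairing_comm (P Q : MvPolynomial (Fin n) ℂ) : pairing P Q = pairing Q P := by
  have : pairingₗ n = (pairingₗ n).flip := linearMap_ext₂ fun ν μ => by
    rw [LinearMap.flip_apply, pairingₗ_apply, pairingₗ_apply, pairing_monomial, pairing_monomial]
    by_cases h : ν = μ
    · subst h; rfl
    · rw [if_neg h, if_neg (Ne.symm h)]
  rw [← pairingₗ_apply, ← pairingₗ_apply, this, LinearMap.flip_apply, ← this]

theorem expFactorial_mul_coeff_diffOp (κ : Fin n →₀ ℕ) (Q P : MvPolynomial (Fin n) ℂ) :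
    expFactorial κ * coeff κ (diffOp n Q P) = pairing (monomial κ 1 * Q) P := by
  have : expFactorial κ • LinearMap.compr₂ (diffOp n) (lcoeff ℂ κ) =
      pairingₗ n ∘ₗ LinearMap.mulLeft ℂ (monomial κ 1) := linearMap_ext₂ fun ν μ => by
    rw [LinearMap.comp_apply, LinearMap.mulLeft_apply, monomial_mul, one_mul, pairingₗ_apply,
      pairing_monomial, ← expFactorial_mul_coeff_diffOp_monomial]
    rfl
  have := LinearMap.congr_fun₂ this Q P
  rw [LinearMap.comp_apply, LinearMap.mulLeft_apply, pairingₗ_apply] at this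
  exact this

theorem pairing_monomial_left (ν : Fin n →₀ ℕ) (P : MvPolynomial (Fin n) ℂ) :
    pairing (monomial ν 1) P = expFactorial ν * coeff ν P := by
  rw [pairing_comm]
  have : (pairingₗ n).flip (monomial ν 1) = expFactorial ν • lcoeff ℂ ν :=
    (basisMonomials (Fin n) ℂ).ext fun μ => by
      rw [coe_basisMonomials, LinearMap.flip_apply, pairingₗ_apply, pairing_monomial,
        LinearMap.smul_apply, lcoeff_apply, coeff_monomial]
      split_ifs <;> simp
  have := LinearMap.congr_fun this P
  rwa [LinearMap.flip_apply, pairingₗ_apply] at this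

theorem eq_zero_of_pairing {P : MvPolynomial (Fin n) ℂ} (h : ∀ Q, pairing Q P = 0) : P = 0 := by
  ext ν
  have := h (monomial ν 1)
  rw [pairing_monomial_left, mul_eq_zero] at this
  simpa using this.resolve_left (expFactorial_ne_zero ν)

/-- By adjointness, the coefficients of `Q(∂)P` are, up to nonzero factorials, the scalar products
of `P` with the multiples `x^κ Q`. -/
theorem mem_SCov_iff (P : MvPolynomial (Fin n) ℂ) :
    P ∈ SCov n m ↔ ∀ Q ∈ quasiIdeal n m, pairing Q P = 0 := by
  constructor
  · intro hP Q hQ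
    have hmon (κ : Fin n →₀ ℕ) (Q) (hQ : Q ∈ QInvPlus n m) :
        pairing (monomial κ 1 * Q) P = 0 := by
      rw [← expFactorial_mul_coeff_diffOp, hP Q hQ, coeff_zero, mul_zero]
    have := map_eq_zero_of_mem_quasiIdeal ((pairingₗ n).flip P) (fun κ Q hQ => by
      rw [LinearMap.flip_apply, pairingₗ_apply, hmon κ Q hQ]) hQ
    rwa [LinearMap.flip_apply, pairingₗ_apply] at this
  · intro h Q hQ
    ext κ
    have := h _ ((quasiIdeal n m).mul_mem_left (monomial κ 1) (Ideal.subset_span hQ))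
    rw [← expFactorial_mul_coeff_diffOp, mul_eq_zero] at this
    simpa using this.resolve_left (expFactorial_ne_zero κ)

end Pairing
end
end QuasiInv

namespace QuasiInv
open List

noncomputable section

/-! ### The monomial basis of the quotient and the dual basis of super-coinvariants. -/

section Basis

variable {n m : ℕ}

/-- The indices of the monomial basis of the quotient: an exponent under the diagonal, and a
residue modulo `m` for each variable. -/
abbrev BasisIndex (n m : ℕ) : Type := {ν // ν ∈ (underDiag n 0).toFinset} × (Fin n → Fin m)

theorem card_basisIndex : Fintype.card (BasisIndex n m) = m ^ n * catalan n := by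
  rw [Fintype.card_prod, Fintype.card_coe, List.toFinset_card_of_nodup (nodup_underDiag n 0),
    length_underDiag_zero, Fintype.card_fun, Fintype.card_fin, Fintype.card_fin, mul_comm]

namespace BasisIndex

theorem length_fst (b : BasisIndex n m) : b.1.1.length = n :=
  ((mem_underDiag _ _ _).1 (List.mem_toFinset.1 b.1.2)).1

theorem not_transDiag_fst (b : BasisIndex n m) : ¬ TransDiag 0 b.1.1 :=
  ((mem_underDiag _ _ _).1 (List.mem_toFinset.1 b.1.2)).2

/-- The exponents of the monomial with index `b`. -/
def exps (b : BasisIndex n m) : Fin n →₀ ℕ :=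
  Finsupp.equivFunOnFinite.symm fun i => b.2 i + m * b.1.1.get (i.cast b.length_fst.symm)

theorem exps_mod (b : BasisIndex n m) (i : Fin n) : b.exps i % m = b.2 i := by
  simp [exps, Nat.mod_eq_of_lt (b.2 i).2]

theorem ofFn_exps_div (b : BasisIndex n m) : (List.ofFn fun i => b.exps i / m) = b.1.1 := by
  have hm (i : Fin n) : 0 < m := (Nat.zero_le _).trans_lt (b.2 i).2
  refine List.ext_get (by simp [length_fst]) fun i h₁ h₂ => ?_
  have hi : i < n := by simpa using h₁
  simp [exps, Nat.add_mul_div_left _ _ (hm ⟨i, hi⟩), Nat.div_eq_of_lt (b.2 ⟨i, hi⟩).2]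

theorem exists_annihilates (b : BasisIndex n m) :
    ∃ ψ : List ℕ → ℂ, Annihilates n ψ ∧ ψ b.1.1 = 1 ∧
      ∀ μ : List ℕ, μ.length = n → ψ μ ≠ 0 → b.1.1 ≤ μ ∧ μ.sum = b.1.1.sum := by
  have := QuasiInv.exists_annihilates (k := ℂ) b.1.1 b.not_transDiag_fst
  rwa [b.length_fst] at this

/-- The functional dual to the monomial with index `b`, up to a triangular change of basis. -/
def functional (b : BasisIndex n m) : MvPolynomial (Fin n) ℂ →ₗ[ℂ] ℂ :=
  residueFunctional b.2 b.exists_annihilates.choose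

theorem functional_eq_zero (hm : 1 ≤ m) (b : BasisIndex n m) {P : MvPolynomial (Fin n) ℂ}
    (hP : P ∈ quasiIdeal n m) : b.functional P = 0 :=
  residueFunctional_eq_zero hm _ b.exists_annihilates.choose_spec.1 hP

theorem functional_self (b : BasisIndex n m) : b.functional (monomial b.exps 1) = 1 := by
  rw [functional, residueFunctional_monomial, if_pos b.exps_mod, ofFn_exps_div]
  exact b.exists_annihilates.choose_spec.2.1

theorem of_functional_ne_zero (b : BasisIndex n m) (ν : Fin n →₀ ℕ)
    (h : b.functional (monomial ν 1) ≠ 0) :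
    (∀ i, ν i % m = b.2 i) ∧ b.1.1 ≤ (List.ofFn fun i => ν i / m) ∧
      (List.ofFn fun i => ν i / m).sum = b.1.1.sum := by
  rw [functional, residueFunctional_monomial] at h
  split_ifs at h with h'
  · exact ⟨h', b.exists_annihilates.choose_spec.2.2 _ length_ofFn h⟩
  · exact absurd rfl h

/-- The matrix of values of the functionals on the monomials. -/
def gram (n m : ℕ) : Matrix (BasisIndex n m) (BasisIndex n m) ℂ :=
  fun b b' => b.functional (monomial b'.exps 1)

/-- Triangularity: given a nonzero kernel vector, take in its support an index whose under-diagonal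
part is lexicographically maximal. In that row only the diagonal entry 1 contributes, because a
nonzero entry forces equal residues and a column part at least as large. -/
theorem isUnit_gram : IsUnit (gram n m) := by
  classical
  rw [← Matrix.mulVec_injective_iff_isUnit, ← Matrix.coe_mulVecLin, ← LinearMap.ker_eq_bot,
    LinearMap.ker_eq_bot']
  intro c hc
  by_contra hne
  obtain ⟨b₀, hb₀⟩ := Function.ne_iff.1 hne
  obtain ⟨b, hb, hmax⟩ := Finset.exists_max_image (Finset.univ.filter fun b => c b ≠ 0)
    (fun b => b.1.1) ⟨b₀, by simpa using hb₀⟩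
  have hcb : c b ≠ 0 := (Finset.mem_filter.1 hb).2
  have h := congrFun hc b
  rw [Matrix.mulVecLin_apply, Matrix.mulVec, dotProduct, Finset.sum_eq_single b] at h
  · rw [gram, functional_self, one_mul] at h
    exact hcb h
  · intro b' _ hbb'
    by_contra h0
    obtain ⟨h₁, h₂⟩ := mul_ne_zero_iff.1 h0
    obtain ⟨h₃, h₄, -⟩ := of_functional_ne_zero b _ h₁
    rw [ofFn_exps_div] at h₄
    have h₅ := hmax b' (by simpa using h₂)
    refine hbb' (Prod.ext (Subtype.ext (le_antisymm h₅ h₄)) (funext fun i => Fin.ext ?_))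
    rw [← exps_mod, h₃]
  · simp

/-- The values of all the functionals. -/
def functionals (n m : ℕ) : MvPolynomial (Fin n) ℂ →ₗ[ℂ] (BasisIndex n m → ℂ) :=
  LinearMap.pi functional

/-- The linear combination of the basis monomials with given coefficients. -/
def combination (n m : ℕ) : (BasisIndex n m → ℂ) →ₗ[ℂ] MvPolynomial (Fin n) ℂ :=
  Fintype.linearCombination ℂ fun b => monomial b.exps 1

theorem functionals_combination (c : BasisIndex n m → ℂ) :
    functionals n m (combination n m c) = (gram n m).mulVec c := by
  funext b
  simp only [functionals, combination, LinearMap.pi_apply, Fintype.linearCombination_apply,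
    map_sum, map_smul, smul_eq_mul, Matrix.mulVec, dotProduct, gram, mul_comm]

theorem mem_sup (hm : 1 ≤ m) (P : MvPolynomial (Fin n) ℂ) :
    P ∈ (quasiIdeal n m).restrictScalars ℂ ⊔ LinearMap.range (combination n m) := by
  classical
  set S := (quasiIdeal n m).restrictScalars ℂ ⊔ LinearMap.range (combination n m) with hS
  have hmon (ν : Fin n →₀ ℕ) : monomial ν (1 : ℂ) ∈ S := by
    let r : Fin n → Fin m := fun i => ⟨ν i % m, Nat.mod_lt _ hm⟩
    let ρ : Fin n →₀ ℕ := Finsupp.equivFunOnFinite.symm fun i => ν i % m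
    let κ : Fin n →₀ ℕ := Finsupp.equivFunOnFinite.symm fun i => ν i / m
    have hν : ν = ρ + m • κ := by
      ext i
      simp [ρ, κ, Nat.mod_add_div]
    -- The reduction acts on the quotient part `κ` in the variables `x_i^m`; pulling `S` back along
    -- multiplication by `x^ρ` keeps the residues fixed.
    have := mon_mem_of_not_transDiag ℂ (I := quasiIdeal n m) (xs := powVars n m)
      (fun a K => Ideal.subset_span (monomialQSym_mem_QInvPlus hm a K))
      (S := S.comap (LinearMap.mulLeft ℂ (monomial ρ 1)))
      (fun y hy => Submodule.mem_sup_left ((quasiIdeal n m).mul_mem_left _ hy))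
      (fun μ hμ ht => ?_) (List.ofFn κ) (by rw [length_ofFn, length_powVars])
    · rw [Submodule.mem_comap, LinearMap.mulLeft_apply, mon_powVars, monomial_mul, one_mul,
        ← hν] at this
      exact this
    · rw [length_powVars] at hμ
      let b : BasisIndex n m :=
        (⟨μ, List.mem_toFinset.2 ((mem_underDiag _ _ _).2 ⟨hμ, ht⟩)⟩, r)
      obtain ⟨κ', rfl⟩ := exists_ofFn_eq hμ
      have hb : b.exps = ρ + m • κ' := by
        ext i
        simp [exps, b, ρ, r]
      refine Submodule.mem_sup_right ⟨Pi.single b 1, ?_⟩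
      rw [combination, Fintype.linearCombination_apply_single, one_smul, hb,
        LinearMap.mulLeft_apply, mon_powVars, monomial_mul, one_mul]
  induction P using MvPolynomial.induction_on' with
  | monomial ν a =>
    have : monomial ν a = a • monomial ν (1 : ℂ) := by simp [smul_monomial]
    rw [this]
    exact S.smul_mem _ (hmon ν)
  | add P Q hP hQ => exact S.add_mem hP hQ

theorem ker_functionals (hm : 1 ≤ m) :
    LinearMap.ker (functionals n m) = (quasiIdeal n m).restrictScalars ℂ := by
  ext P
  rw [LinearMap.mem_ker, Submodule.restrictScalars_mem]
  constructor
  · intro hP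
    obtain ⟨Q, hQ, _, ⟨c, rfl⟩, rfl⟩ := Submodule.mem_sup.1 (mem_sup hm P)
    have hQ0 : functionals n m Q = 0 := funext fun b => functional_eq_zero hm b hQ
    rw [map_add, hQ0, zero_add, functionals_combination] at hP
    have hc : c = 0 :=
      Matrix.mulVec_injective_iff_isUnit.2 isUnit_gram (by rw [hP, Matrix.mulVec_zero])
    rw [hc, map_zero, add_zero]
    exact hQ
  · exact fun hP => funext fun b => functional_eq_zero hm b hP

theorem functionals_surjective : Function.Surjective (functionals n m) := fun c => by
  have h : Function.Surjective (gram n m).mulVec := by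
    rw [Matrix.mulVec_surjective_iff_isUnit]
    exact isUnit_gram
  obtain ⟨d, rfl⟩ := h c
  exact ⟨_, functionals_combination d⟩

/-- Coordinates on the quotient by the ideal of quasi-invariants without constant term. -/
def quotientEquiv (hm : 1 ≤ m) :
    (MvPolynomial (Fin n) ℂ ⧸ quasiIdeal n m) ≃ₗ[ℂ] (BasisIndex n m → ℂ) :=
  (Submodule.Quotient.restrictScalarsEquiv ℂ (quasiIdeal n m)).symm ≪≫ₗ
    Submodule.quotEquivOfEq _ _ (ker_functionals hm).symm ≪≫ₗ
    (functionals n m).quotKerEquivOfSurjective functionals_surjective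

/-- The residues and the sum of the quotients are prescribed, so the exponents are bounded.
Finiteness is what lets a polynomial represent the functional. -/
theorem finite_functional_ne_zero (b : BasisIndex n m) :
    {ν : Fin n →₀ ℕ | b.functional (monomial ν 1) ≠ 0}.Finite := by
  refine (Set.finite_Iic (Finsupp.equivFunOnFinite.symm fun _ : Fin n =>
    m * b.1.1.sum + m)).subset fun ν hν i => ?_
  obtain ⟨h₁, -, h₂⟩ := of_functional_ne_zero b ν hν
  have h₃ : ν i / m ≤ b.1.1.sum := by
    rw [← h₂]
    exact List.le_sum_of_mem (List.mem_ofFn.2 ⟨i, rfl⟩)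
  have h₄ := Nat.mul_le_mul_left m h₃
  have h₅ := Nat.mod_add_div (ν i) m
  have h₆ := (b.2 i).2
  have h₇ := h₁ i
  simp only [Finsupp.equivFunOnFinite_symm_apply_apply]
  omega

/-- The polynomial representing the functional with index `b` through the scalar product. -/
def dualPoly (b : BasisIndex n m) : MvPolynomial (Fin n) ℂ :=
  ∑ ν ∈ b.finite_functional_ne_zero.toFinset,
    monomial ν ((expFactorial ν)⁻¹ * b.functional (monomial ν 1))

theorem pairing_dualPoly (b : BasisIndex n m) (P : MvPolynomial (Fin n) ℂ) :
    pairing P b.dualPoly = b.functional P := by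
  have : (pairingₗ n).flip b.dualPoly = b.functional :=
    (basisMonomials (Fin n) ℂ).ext fun ν => by
      rw [coe_basisMonomials, LinearMap.flip_apply, pairingₗ_apply, pairing_monomial_left,
        dualPoly, coeff_sum]
      simp only [coeff_monomial]
      rw [Finset.sum_ite_eq']
      split_ifs with h
      · rw [mul_inv_cancel_left₀ (expFactorial_ne_zero ν)]
      · rw [mul_zero]
        by_contra h0
        exact h ((Set.Finite.mem_toFinset _).2 (Ne.symm h0))
  rw [← this, LinearMap.flip_apply, pairingₗ_apply]

/-- The scalar products of a super-coinvariant polynomial with the basis monomials. -/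
def coordinates (n m : ℕ) : SCov n m →ₗ[ℂ] (BasisIndex n m → ℂ) :=
  LinearMap.pi fun b => (pairingₗ n (monomial b.exps 1)) ∘ₗ (SCov n m).subtype

theorem coordinates_apply (P : SCov n m) (b : BasisIndex n m) :
    coordinates n m P b = pairing (monomial b.exps 1) (P : MvPolynomial (Fin n) ℂ) := by
  rw [← pairingₗ_apply]
  rfl

/-- A super-coinvariant is orthogonal to the ideal; if also orthogonal to monomials spanning a
complement, it is orthogonal to everything, and the pairing is nondegenerate. -/
theorem coordinates_injective (hm : 1 ≤ m) : Function.Injective (coordinates n m) := by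
  rw [← LinearMap.ker_eq_bot, LinearMap.ker_eq_bot']
  intro P hP
  refine Subtype.ext (eq_zero_of_pairing fun Q => ?_)
  obtain ⟨S, hS, _, ⟨c, rfl⟩, rfl⟩ := Submodule.mem_sup.1 (mem_sup hm Q)
  rw [← pairingₗ_apply, map_add, LinearMap.add_apply, pairingₗ_apply,
    (mem_SCov_iff _).1 P.2 S hS, zero_add, combination, Fintype.linearCombination_apply, map_sum,
    LinearMap.sum_apply]
  refine Finset.sum_eq_zero fun b _ => ?_
  rw [map_smul, LinearMap.smul_apply, pairingₗ_apply, ← coordinates_apply, hP, Pi.zero_apply,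
    smul_zero]

/-- The polynomials `dualPoly b` are super-coinvariant, and their coordinate vectors are the rows of
the invertible matrix `gram`. -/
theorem coordinates_surjective (hm : 1 ≤ m) : Function.Surjective (coordinates n m) := fun c => by
  classical
  obtain ⟨d, rfl⟩ := Matrix.vecMul_surjective_iff_isUnit.2 (isUnit_gram (n := n) (m := m)) c
  have hmem (b : BasisIndex n m) : b.dualPoly ∈ SCov n m :=
    (mem_SCov_iff _).2 fun Q hQ => by rw [pairing_dualPoly, functional_eq_zero hm b hQ]
  refine ⟨∑ b, d b • ⟨b.dualPoly, hmem b⟩, ?_⟩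
  funext b'
  rw [map_sum, Finset.sum_apply]
  refine Finset.sum_congr rfl fun b _ => ?_
  rw [map_smul, Pi.smul_apply, coordinates_apply, pairing_dualPoly]
  rfl

/-- Coordinates on the space of super-coinvariant polynomials. -/
def superCoinvariantEquiv (hm : 1 ≤ m) : SCov n m ≃ₗ[ℂ] (BasisIndex n m → ℂ) :=
  LinearEquiv.ofBijective (coordinates n m) ⟨coordinates_injective hm, coordinates_surjective hm⟩

end BasisIndex

end Basis

end
end QuasiInv

theorem mainTheorem1 (n m : ℕ) (hm : 1 ≤ m) :
    -- the space of super-coinvariants is the orthogonal of the ideal ...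
    (∀ P : MvPolynomial (Fin n) ℂ,
      P ∈ QuasiInv.SCov n m ↔ ∀ Q ∈ QuasiInv.quasiIdeal n m, QuasiInv.pairing P Q = 0) ∧
    -- ... is isomorphic to the quotient by the ideal ...
    Nonempty (QuasiInv.SCov n m ≃ₗ[ℂ]
      (MvPolynomial (Fin n) ℂ ⧸ QuasiInv.quasiIdeal n m)) ∧
    -- ... and has dimension `m ^ n * C_n`
    Module.rank ℂ (QuasiInv.SCov n m) = ((m ^ n * catalan n : ℕ) : Cardinal) ∧
    ((m ^ n * catalan n : ℕ) : ℚ) =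
      (m : ℚ) ^ n * (1 / ((n : ℚ) + 1)) * (Nat.choose (2 * n) n : ℚ) := by
  refine ⟨fun P => ?_, ⟨(QuasiInv.BasisIndex.superCoinvariantEquiv hm).trans
    (QuasiInv.BasisIndex.quotientEquiv hm).symm⟩, ?_, ?_⟩
  · simp only [QuasiInv.mem_SCov_iff, QuasiInv.pairing_comm P]
  · rw [(QuasiInv.BasisIndex.superCoinvariantEquiv hm).rank_eq, rank_fun',
      QuasiInv.card_basisIndex]
  · have h : ((n : ℚ) + 1) * catalan n = Nat.choose (2 * n) n := by
      exact_mod_cast succ_mul_catalan_eq_centralBinom n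
    have hn : (n : ℚ) + 1 ≠ 0 := by positivity
    rw [← h]
    push_cast
    field_simp
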